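/- Let $n\ge 1$ and let $\Omega_1\subset\Omega_2\subset\cdots$ be domains (nonempty connected open sets) in $\mathbb{C}^n$ with union $\Omega=\bigcup_j\Omega_j$, and assume that $\Omega$ is a non-trivial Bergman domain, i.e. that the Bergman space $A^2(\Omega)$ of square-integrable holomorphic functions on $\Omega$ is not $\{0\}$. For a domain $U$ let $K^U$ be its Bergman kernel, put $\mathcal{Z}=\{z\in\Omega: K^\Omega(z,z)=0\}$, let $k^U_z=K^U(\cdot,z)/\sqrt{K^U(z,z)}$ whenever $K^U(z,z)\neq0$, and for a bounded linear operator $T$ on $A^2(U)$ let $B_UT(z)=\langle Tk^U_z,k^U_z\rangle$ be its Berezin transform. For a measurable function $\phi$ on $U$, the Toeplitz operator $T_\phi$ on $A^2(U)$ is $$T_\phi f(z)=P_U(\phi f)(z)=\int_U K^U(z,w)\phi(w)f(w)\,dV(w),$$ and "$T_\phi$ is bounded on $A^2(U)$" means that there is a bounded linear operator on $A^2(U)$, again denoted $T_\phi$, which is given by this formula (with absolutely convergent integrals for all $z\in U$) for a dense set of $f\in A^2(U)$; if $\phi$ is bounded, this is the case for exactly one operator, and the formula holds for all $f\in A^2(U)$.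 If $T_\phi$ is bounded, write $B_U\phi=B_UT_\phi$. Let $\phi\in L^q(\Omega)$ for some $0<q<\infty$ be such that $T_\phi$ is bounded on $A^2(\Omega)$. Then there exist a subsequence $j_1<j_2<\cdots$ and functions $\phi_k\in L^\infty(\Omega_{j_k})$ such that $$B_{\Omega_{j_k}}\phi_k\to B_\Omega\phi\quad\text{uniformly on compact subsets of }\Omega\setminus\mathcal{Z}\text{ as }k\to\infty.$$ If, in addition, $\Omega$ is bounded, then, for the same $j_k$ and $\phi_k$, the functions $B_\Omega\phi$ and $E B_{\Omega_{j_k}}\phi_k$ belong to $L^p(\Omega)$ and $E B_{\Omega_{j_k}}\phi_k\to B_\Omega\phi$ in $L^p(\Omega)$ as $k\to\infty$ for all $0<p<\infty$, where $E$ denotes extension by zero. -/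

import Mathlib

open MeasureTheory Filter Topology Set
open scoped ENNReal

noncomputable section

namespace Bergman

variable {n : ℕ}

/-- A domain in `ℂⁿ`: a nonempty connected open set. -/
def IsDomainSet (Ω : Set (Fin n → ℂ)) : Prop :=
  IsOpen Ω ∧ IsConnected Ω

/-- The Bergman space `A²(Ω)`: the classes in `L²(Ω)` that have a holomorphic representative
(holomorphic: complex differentiable on the open set `Ω`). It carries the norm and the inner
product of `L²(Ω)`. -/
def A2 (Ω : Set (Fin n → ℂ)) : Submodule ℂ (Lp ℂ 2 (volume.restrict Ω)) where
  carrier := {f | ∃ g : (Fin n → ℂ) → ℂ, DifferentiableOn ℂ g Ω ∧ f =ᵐ[volume.restrict Ω] g}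
  add_mem' := by
    rintro f₁ f₂ ⟨g₁, hg₁, h₁⟩ ⟨g₂, hg₂, h₂⟩
    exact ⟨g₁ + g₂, hg₁.add hg₂, (Lp.coeFn_add f₁ f₂).trans (h₁.add h₂)⟩
  zero_mem' := ⟨0, differentiableOn_const 0, Lp.coeFn_zero ℂ 2 _⟩
  smul_mem' := by
    rintro c f ⟨g, hg, h⟩
    exact ⟨c • g, hg.const_smul c, (Lp.coeFn_smul c f).trans (h.const_smul c)⟩

/-- The holomorphic function on `Ω` represented by `f ∈ A²(Ω)`, extended by zero. -/
def hol {Ω : Set (Fin n → ℂ)} (f : A2 Ω) : (Fin n → ℂ) → ℂ :=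
  Ω.indicator f.2.choose

theorem differentiableOn_hol {Ω : Set (Fin n → ℂ)} (f : A2 Ω) :
    DifferentiableOn ℂ (hol f) Ω :=
  f.2.choose_spec.1.congr fun _ hz => indicator_of_mem hz _

theorem coeFn_ae_eq_hol {Ω : Set (Fin n → ℂ)} (hΩ : IsOpen Ω) (f : A2 Ω) :
    (f : Lp ℂ 2 (volume.restrict Ω)) =ᵐ[volume.restrict Ω] hol f := by
  refine f.2.choose_spec.2.trans ?_
  filter_upwards [ae_restrict_mem hΩ.measurableSet] with z hz
  exact (indicator_of_mem hz _).symm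

/-- The holomorphic representative is unique on `Ω`. -/
theorem hol_eqOn {Ω : Set (Fin n → ℂ)} (hΩ : IsOpen Ω) (f : A2 Ω) {g : (Fin n → ℂ) → ℂ}
    (hg : DifferentiableOn ℂ g Ω)
    (h : (f : Lp ℂ 2 (volume.restrict Ω)) =ᵐ[volume.restrict Ω] g) :
    EqOn (hol f) g Ω :=
  Measure.eqOn_open_of_ae_eq ((coeFn_ae_eq_hol hΩ f).symm.trans h) hΩ
    (differentiableOn_hol f).continuousOn hg.continuousOn

/-- `k` reproduces the value at `z`: `f(z) = ⟨f, k⟩` for all `f ∈ A²(Ω)`.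
(Mathlib's inner product is conjugate linear in its first argument.) -/
def IsReproducing (Ω : Set (Fin n → ℂ)) (z : Fin n → ℂ) (k : A2 Ω) : Prop :=
  ∀ f : A2 Ω, inner ℂ k f = hol f z

theorem IsReproducing.unique {Ω : Set (Fin n → ℂ)} {z : Fin n → ℂ} {k k' : A2 Ω}
    (h : IsReproducing Ω z k) (h' : IsReproducing Ω z k') : k = k' :=
  ext_inner_right ℂ fun f => (h f).trans (h' f).symm

open Classical in
/-- The Bergman kernel function `K_z^Ω = K^Ω(·, z) ∈ A²(Ω)`: the unique element of `A²(Ω)` that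
reproduces the value at `z`. For open `Ω` it exists, since `A²(Ω)` is complete and point
evaluations are bounded; so the value `0` of the `else` branch is never used. -/
def kernelFun (Ω : Set (Fin n → ℂ)) (z : Fin n → ℂ) : A2 Ω :=
  if h : ∃ k : A2 Ω, IsReproducing Ω z k then h.choose else 0

/-- The Bergman kernel `K^Ω(w, z)`. -/
def bergmanKernel (Ω : Set (Fin n → ℂ)) (w z : Fin n → ℂ) : ℂ :=
  hol (kernelFun Ω z) w

/-- `𝒵 = {z ∈ Ω : K^Ω(z, z) = 0}`. -/
def zeroSet (Ω : Set (Fin n → ℂ)) : Set (Fin n → ℂ) :=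
  {z ∈ Ω | bergmanKernel Ω z z = 0}

/-- The normalized kernel `k_z^Ω = K^Ω(·, z) / √K^Ω(z, z)`; `K^Ω(z, z)` is real and nonnegative.
It is meaningful for `z ∈ Ω ∖ 𝒵`, and `0` for all other `z`. -/
def normalizedKernel (Ω : Set (Fin n → ℂ)) (z : Fin n → ℂ) : A2 Ω :=
  ((Real.sqrt (bergmanKernel Ω z z).re : ℂ))⁻¹ • kernelFun Ω z

/-- The Berezin transform `B_Ω T(z) = ⟨T k_z, k_z⟩` of a bounded operator `T` on `A²(Ω)`. -/
def berezin {Ω : Set (Fin n → ℂ)} (T : A2 Ω →L[ℂ] A2 Ω) (z : Fin n → ℂ) : ℂ :=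
  inner ℂ (normalizedKernel Ω z) (T (normalizedKernel Ω z))

/-- `Ω` is a non-trivial Bergman domain. -/
def IsNontrivialBergmanDomain (Ω : Set (Fin n → ℂ)) : Prop :=
  IsDomainSet Ω ∧ A2 Ω ≠ ⊥

/-- `f` is in the domain of the Toeplitz operator `T_φ f = P_Ω(φ f)` and `g = T_φ f`, where
the Bergman projection `P_Ω` is written through its kernel:
`g(z) = ∫_Ω K^Ω(z, w) φ(w) f(w) dV(w)` for all `z ∈ Ω`, with absolutely convergent integrals. -/
def ToeplitzEq (Ω : Set (Fin n → ℂ)) (φ : (Fin n → ℂ) → ℂ) (f g : A2 Ω) : Prop :=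
  ∀ z ∈ Ω, IntegrableOn (fun w => bergmanKernel Ω z w * φ w * hol f w) Ω ∧
    hol g z = ∫ w in Ω, bergmanKernel Ω z w * φ w * hol f w

/-- `T_φ` is bounded on `A²(Ω)`, with bounded extension `T`: the bounded operator `T` satisfies
`T f = T_φ f` for a dense set (automatically a linear subspace) of `f ∈ A²(Ω)`. For bounded `φ`
this holds for exactly one `T`, namely `f ↦ P_Ω(φ f)`; for an unbounded `φ` the product `φ f` need
not be square integrable for every `f ∈ A²(Ω)`, so `T_φ f` is only required to be given
by the integral for a dense set of `f`. -/
def IsToeplitz (Ω : Set (Fin n → ℂ)) (φ : (Fin n → ℂ) → ℂ) (T : A2 Ω →L[ℂ] A2 Ω) : Prop :=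
  Dense {f : A2 Ω | ToeplitzEq Ω φ f (T f)}

end Bergman

end

noncomputable section

namespace Bergman

variable {n : ℕ}

/-! Two facts carry the proof. On `Ω`, Toeplitz operators with bounded, compactly supported symbols
approximate the quadratic form of any bounded `T` on compact sets of vectors. For one fixed such
symbol, the Berezin transforms on `Ω_j` are close to the one on `Ω` when `j` is large.

Density (`exists_compactToeplitz_approx`). Averaging over a small ball around `z` gives a Toeplitz
operator close in norm to the rank one operator `K_z ⊗ K_z`. Since `K_z` is conjugate holomorphic in
`z`, analytic continuation from the diagonal puts all `K_a ⊗ K_b` into the closure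
(`rankOne_mem_of_forall_rankOne_self_mem`), hence every rank one operator, hence `T P_V` for every
finite dimensional `V`. If `V` lies near the compact set of normalized kernels under consideration,
`T P_V` has almost the same Berezin transform there as `T`, and its norm is at most `‖T‖`.

Transfer. Extended by zero, all Bergman spaces sit in `L²(ℂⁿ)`, and the squared distance between the
kernel functions of nested domains at a point is the difference of their diagonal values
(`norm_extendL_kernelFun_sub_sq`). Ramadanov's theorem and Dini's theorem make this difference
uniformly small on compact sets. This gives convergence of Berezin transforms on compact subsets of
`Ω ∖ 𝒵`. It also gives a bound close to `‖T‖` on all of `Ω_j`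
(`eventually_norm_berezin_toeplitz_le`), although the sup norms of the symbols are not controlled.

A diagonal choice along a compact exhaustion yields the sequence. On a bounded domain `𝒵` is empty,
and the uniform bound allows dominated convergence in `Lᵖ`. -/

/-- The inner product of `A²(U)` as a subspace of `L²(U)`. -/
instance innerA2 (U : Set (Fin n → ℂ)) : Inner ℂ (A2 U) :=
  (Submodule.innerProductSpace (A2 U)).toInner

/-! ### The mean value property and local estimates -/

/-- One-variable mean value property on the slice `ζ ↦ z + ζ v`, which maps the closed unit disc
into the ball. -/
theorem circle_mean_eq {f : (Fin n → ℂ) → ℂ} {U : Set (Fin n → ℂ)} (hU : IsOpen U)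
    (hf : DifferentiableOn ℂ f U) {z v : Fin n → ℂ} {r : ℝ} (hr : Metric.closedBall z r ⊆ U)
    (hv : ‖v‖ ≤ r) :
    ∫ θ in (0 : ℝ)..2 * Real.pi, f (z + circleMap 0 1 θ • v) = (2 * Real.pi) * f z := by
  have hmaps : MapsTo (fun ζ : ℂ => z + ζ • v) (Metric.closedBall 0 1) U := by
    intro ζ hζ
    refine hr ?_
    rw [mem_closedBall_iff_norm, add_sub_cancel_left, norm_smul]
    rw [mem_closedBall_zero_iff] at hζ
    nlinarith [norm_nonneg v, norm_nonneg ζ]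
  have hd : DifferentiableOn ℂ (fun ζ : ℂ => f (z + ζ • v)) (Metric.closedBall 0 1) := by
    intro ζ hζ
    have h1 : DifferentiableAt ℂ f (z + ζ • v) := hf.differentiableAt (hU.mem_nhds (hmaps hζ))
    exact (DifferentiableAt.comp (f := fun ζ : ℂ => z + ζ • v) ζ h1
      (by fun_prop)).differentiableWithinAt
  have hmean := DiffContOnCl.circleAverage (f := fun ζ : ℂ => f (z + ζ • v)) (c := 0) (R := 1)
    (by
      refine DifferentiableOn.diffContOnCl ?_
      rwa [abs_one, closure_ball _ one_ne_zero])
  rw [Real.circleAverage_def] at hmean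
  simp only [zero_smul, add_zero] at hmean
  rw [← hmean, Complex.real_smul, ← mul_assoc]
  push_cast
  rw [mul_inv_cancel₀ (by exact_mod_cast Real.two_pi_pos.ne'), one_mul]

theorem measurePreserving_unit_smul (θ : ℝ) :
    MeasurePreserving (fun v : Fin n → ℂ => circleMap 0 1 θ • v) volume volume := by
  have h := volume_preserving_pi (fun _ : Fin n =>
    (rotation (Circle.exp θ)).measurePreserving)
  have heq : (fun v : Fin n → ℂ => circleMap 0 1 θ • v)
      = fun v i => rotation (Circle.exp θ) (v i) := by
    ext v i
    simp [circleMap, Circle.coe_exp]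
  rw [heq]
  exact h

theorem setIntegral_closedBall_unit_smul (f : (Fin n → ℂ) → ℂ) (z : Fin n → ℂ) (r θ : ℝ) :
    ∫ v in Metric.closedBall (0 : Fin n → ℂ) r, f (z + circleMap 0 1 θ • v)
      = ∫ w in Metric.closedBall z r, f w := by
  have hne : circleMap 0 1 θ ≠ 0 := by simp
  have h1 : MeasurePreserving (fun v : Fin n → ℂ => z + circleMap 0 1 θ • v) volume volume :=
    (measurePreserving_add_left volume z).comp (measurePreserving_unit_smul θ)
  have h2 : MeasurableEmbedding (fun v : Fin n → ℂ => z + circleMap 0 1 θ • v) :=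
    (measurableEmbedding_addLeft z).comp (measurableEmbedding_const_smul₀ hne)
  have h3 := h1.setIntegral_preimage_emb h2 f (Metric.closedBall z r)
  rw [← h3]
  congr 2
  ext v
  simp [norm_smul]

/-- The ball is invariant under `v ↦ e^{iθ} v`. Averaging over `θ` and applying Fubini reduces the
volume mean to circle means. -/
theorem setIntegral_closedBall {f : (Fin n → ℂ) → ℂ} {U : Set (Fin n → ℂ)} (hU : IsOpen U)
    (hf : DifferentiableOn ℂ f U) {z : Fin n → ℂ} {r : ℝ} (hr : Metric.closedBall z r ⊆ U) :
    ∫ w in Metric.closedBall z r, f w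
      = (volume.real (Metric.closedBall (0 : Fin n → ℂ) r) : ℂ) * f z := by
  have hcont : ContinuousOn (Function.uncurry fun (θ : ℝ) (v : Fin n → ℂ) =>
      f (z + circleMap 0 1 θ • v)) (uIcc 0 (2 * Real.pi) ×ˢ Metric.closedBall 0 r) := by
    refine hf.continuousOn.comp (f := fun p : ℝ × (Fin n → ℂ) => z + circleMap 0 1 p.1 • p.2)
      (Continuous.continuousOn (by fun_prop)) ?_
    rintro ⟨θ, v⟩ ⟨-, hv⟩
    refine hr ?_
    simp only [mem_closedBall_iff_norm, add_sub_cancel_left, norm_smul] at hv ⊢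
    simpa using hv
  have hint : Integrable (Function.uncurry fun (θ : ℝ) (v : Fin n → ℂ) =>
      f (z + circleMap 0 1 θ • v))
      ((volume.restrict (uIoc 0 (2 * Real.pi))).prod
        (volume.restrict (Metric.closedBall (0 : Fin n → ℂ) r))) := by
    rw [Measure.prod_restrict]
    exact (hcont.integrableOn_compact
      (isCompact_uIcc.prod (isCompact_closedBall _ _))).mono_set
        (prod_mono uIoc_subset_uIcc Subset.rfl)
  have hswap := integral_integral_swap hint
  have hpi : (0 : ℝ) ≤ 2 * Real.pi := Real.two_pi_pos.le
  simp only [uIoc_of_le hpi, ← intervalIntegral.integral_of_le hpi,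
    setIntegral_closedBall_unit_smul] at hswap
  have h2 : ∫ v in Metric.closedBall (0 : Fin n → ℂ) r,
      (∫ θ in (0 : ℝ)..2 * Real.pi, f (z + circleMap 0 1 θ • v))
      = ∫ v in Metric.closedBall (0 : Fin n → ℂ) r, (2 * Real.pi) * f z :=
    setIntegral_congr_fun measurableSet_closedBall fun v hv =>
      circle_mean_eq hU hf hr (by simpa using hv)
  rw [h2] at hswap
  simp only [intervalIntegral.integral_const, sub_zero, setIntegral_const, Complex.real_smul]
    at hswap
  push_cast at hswap
  have hpi' : (2 * Real.pi : ℂ) ≠ 0 := by exact_mod_cast Real.two_pi_pos.ne'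
  refine mul_left_cancel₀ hpi' ?_
  rw [hswap]
  ring

theorem hol_of_notMem {U : Set (Fin n → ℂ)} (f : A2 U) {z : Fin n → ℂ} (hz : z ∉ U) :
    hol f z = 0 :=
  indicator_of_notMem hz _

theorem hol_add {U : Set (Fin n → ℂ)} (hU : IsOpen U) (f g : A2 U) (z : Fin n → ℂ) :
    hol (f + g) z = hol f z + hol g z := by
  by_cases hz : z ∈ U
  · refine hol_eqOn hU (f + g) (g := fun z => hol f z + hol g z)
      ((differentiableOn_hol f).add (differentiableOn_hol g)) ?_ hz
    exact (Lp.coeFn_add _ _).trans ((coeFn_ae_eq_hol hU f).add (coeFn_ae_eq_hol hU g))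
  · simp [hol_of_notMem, hz]

theorem hol_smul {U : Set (Fin n → ℂ)} (hU : IsOpen U) (c : ℂ) (f : A2 U) (z : Fin n → ℂ) :
    hol (c • f) z = c * hol f z := by
  by_cases hz : z ∈ U
  · refine hol_eqOn hU (c • f) (g := fun z => c * hol f z)
      ((differentiableOn_hol f).const_mul c) ?_ hz
    exact (Lp.coeFn_smul _ _).trans ((coeFn_ae_eq_hol hU f).const_smul c)
  · simp [hol_of_notMem, hz]

theorem hol_sub {U : Set (Fin n → ℂ)} (hU : IsOpen U) (f g : A2 U) (z : Fin n → ℂ) :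
    hol (f - g) z = hol f z - hol g z := by
  have h := hol_add hU (f - g) g z
  rw [sub_add_cancel] at h
  rw [h, add_sub_cancel_right]

/-- The constant in the sub-mean-value estimate on balls of radius `r`. -/
def ballConst (n : ℕ) (r : ℝ) : ℝ :=
  (volume.real (Metric.closedBall (0 : Fin n → ℂ) r))⁻¹ *
    volume.real (Metric.closedBall (0 : Fin n → ℂ) r) ^ (1 / (2 : ℝ≥0∞).toReal)

theorem ballConst_nonneg (n : ℕ) (r : ℝ) : 0 ≤ ballConst n r := by
  unfold ballConst; positivity

theorem volumeReal_closedBall_pos {r : ℝ} (hr : 0 < r) (z : Fin n → ℂ) :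
    0 < volume.real (Metric.closedBall z r) := by
  rw [measureReal_def]
  exact ENNReal.toReal_pos (Metric.measure_closedBall_pos _ _ hr).ne'
    (isCompact_closedBall _ _).measure_lt_top.ne

/-- Cauchy–Schwarz against the indicator of the ball, whose pairing with `f` is the volume times the
value at the centre. -/
theorem norm_hol_le {U : Set (Fin n → ℂ)} (hU : IsOpen U) (f : A2 U) {z : Fin n → ℂ} {r : ℝ}
    (hr : 0 < r) (hzr : Metric.closedBall z r ⊆ U) : ‖hol f z‖ ≤ ballConst n r * ‖f‖ := by
  set B := Metric.closedBall z r
  have hBm : MeasurableSet B := measurableSet_closedBall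
  have hBfin : (volume.restrict U) B ≠ ∞ :=
    ((Measure.restrict_apply_le _ _).trans_lt (isCompact_closedBall _ _).measure_lt_top).ne
  have hvol : volume.real B = volume.real (Metric.closedBall (0 : Fin n → ℂ) r) := by
    rw [measureReal_def, measureReal_def, Measure.addHaar_closedBall_center]
  have hrestr : (volume.restrict U).restrict B = volume.restrict B := by
    rw [Measure.restrict_restrict hBm, inter_eq_left.2 hzr]
  have h1 : inner ℂ (indicatorConstLp 2 hBm hBfin (1 : ℂ)) (f : Lp ℂ 2 (volume.restrict U))
      = (volume.real B : ℂ) * hol f z := by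
    rw [L2.inner_indicatorConstLp_one, hrestr, hvol,
      ← setIntegral_closedBall hU (differentiableOn_hol f) hzr]
    refine integral_congr_ae ?_
    exact ae_restrict_of_ae_restrict_of_subset hzr (coeFn_ae_eq_hol hU f)
  have h2 := norm_inner_le_norm (𝕜 := ℂ) (indicatorConstLp 2 hBm hBfin (1 : ℂ))
    (f : Lp ℂ 2 (volume.restrict U))
  rw [h1, norm_mul, norm_indicatorConstLp two_ne_zero ENNReal.ofNat_ne_top, norm_one, one_mul,
    measureReal_restrict_apply hBm, inter_eq_left.2 hzr, Complex.norm_real, Real.norm_eq_abs,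
    abs_of_nonneg measureReal_nonneg] at h2
  have hpos := volumeReal_closedBall_pos hr z
  rw [ballConst, ← hvol, mul_assoc, ← div_eq_inv_mul, le_div_iff₀ hpos, mul_comm]
  exact h2

theorem norm_hol_le_of_mem_ball {U : Set (Fin n → ℂ)} (hU : IsOpen U) (f : A2 U)
    {z₀ z : Fin n → ℂ} {r : ℝ} (hr : 0 < r) (hzr : Metric.closedBall z₀ (3 * r) ⊆ U)
    (hz : z ∈ Metric.ball z₀ (2 * r)) : ‖hol f z‖ ≤ ballConst n r * ‖f‖ := by
  refine norm_hol_le hU f hr ((Metric.closedBall_subset_closedBall' ?_).trans hzr)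
  rw [Metric.mem_ball] at hz
  linarith

/-- Input for the Schwarz lemma. The radii fit because `ball w r` lies in `ball z₀ (2 * r)`, where
balls of radius `r` still stay inside `closedBall z₀ (3 * r)`. -/
theorem mapsTo_hol_ball {U : Set (Fin n → ℂ)} (hU : IsOpen U) (f : A2 U)
    {z₀ w : Fin n → ℂ} {r : ℝ} (hr : 0 < r) (hzr : Metric.closedBall z₀ (3 * r) ⊆ U)
    (hw : w ∈ Metric.ball z₀ (r / 2)) :
    MapsTo (hol f) (Metric.ball w r)
      (Metric.closedBall (hol f w) (2 * (ballConst n r * ‖f‖))) := by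
  intro z hz
  rw [mem_closedBall_iff_norm]
  have h1 := norm_hol_le_of_mem_ball hU f hr hzr (z := z)
    (by rw [Metric.mem_ball] at *; linarith [dist_triangle z w z₀])
  have h2 := norm_hol_le_of_mem_ball hU f hr hzr (z := w)
    (by rw [Metric.mem_ball] at *; linarith)
  linarith [norm_sub_le (hol f z) (hol f w)]

theorem differentiableOn_hol_ball {U : Set (Fin n → ℂ)} (f : A2 U)
    {z₀ w : Fin n → ℂ} {r : ℝ} (hr : 0 < r) (hzr : Metric.closedBall z₀ (3 * r) ⊆ U)
    (hw : w ∈ Metric.ball z₀ (r / 2)) :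
    DifferentiableOn ℂ (hol f) (Metric.ball w r) := by
  refine (differentiableOn_hol f).mono (Subset.trans ?_ hzr)
  refine Metric.ball_subset_closedBall.trans (Metric.closedBall_subset_closedBall' ?_)
  rw [Metric.mem_ball] at hw
  linarith

theorem norm_hol_sub_le {U : Set (Fin n → ℂ)} (hU : IsOpen U) (f : A2 U)
    {z₀ z w : Fin n → ℂ} {r : ℝ} (hr : 0 < r) (hzr : Metric.closedBall z₀ (3 * r) ⊆ U)
    (hz : z ∈ Metric.ball z₀ (r / 2)) (hw : w ∈ Metric.ball z₀ (r / 2)) :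
    ‖hol f z - hol f w‖ ≤ 2 * ballConst n r / r * dist z w * ‖f‖ := by
  have h := Complex.dist_le_div_mul_dist_of_mapsTo_ball (differentiableOn_hol_ball f hr hzr hw)
    (mapsTo_hol_ball hU f hr hzr hw) (z := z)
    (by rw [Metric.mem_ball] at *; linarith [dist_triangle_right z w z₀])
  rw [dist_eq_norm (hol f z)] at h
  refine h.trans_eq ?_
  ring

theorem norm_fderiv_hol_le {U : Set (Fin n → ℂ)} (hU : IsOpen U) (f : A2 U)
    {z₀ w : Fin n → ℂ} {r : ℝ} (hr : 0 < r) (hzr : Metric.closedBall z₀ (3 * r) ⊆ U)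
    (hw : w ∈ Metric.ball z₀ (r / 2)) :
    ‖fderiv ℂ (hol f) w‖ ≤ 2 * ballConst n r / r * ‖f‖ := by
  have h := Complex.norm_fderiv_le_div_of_mapsTo_ball (differentiableOn_hol_ball f hr hzr hw)
    (mapsTo_hol_ball hU f hr hzr hw) hr
  refine h.trans_eq ?_
  ring

theorem exists_closedBall_three_subset {U : Set (Fin n → ℂ)} (hU : IsOpen U) {z : Fin n → ℂ}
    (hz : z ∈ U) : ∃ r > 0, Metric.closedBall z (3 * r) ⊆ U := by
  obtain ⟨ε, hε, h⟩ := Metric.nhds_basis_closedBall.mem_iff.1 (hU.mem_nhds hz)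
  exact ⟨ε / 3, by positivity, by rwa [mul_div_cancel₀ _ three_ne_zero]⟩

/-! ### The Bergman space is a Hilbert space with continuous evaluations -/

/-- Evaluation at `z ∈ U` as a continuous linear functional on `A²(U)`. -/
def evalL {U : Set (Fin n → ℂ)} (hU : IsOpen U) (z : Fin n → ℂ) (hz : z ∈ U) : A2 U →L[ℂ] ℂ :=
  LinearMap.mkContinuousOfExistsBound
    { toFun := fun f => hol f z
      map_add' := fun f g => hol_add hU f g z
      map_smul' := fun c f => hol_smul hU c f z }
    (by
      obtain ⟨r, hr, h⟩ := exists_closedBall_three_subset hU hz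
      exact ⟨ballConst n r, fun f => norm_hol_le_of_mem_ball hU f hr h
        (Metric.mem_ball_self (by positivity))⟩)

@[simp]
theorem evalL_apply {U : Set (Fin n → ℂ)} (hU : IsOpen U) (z : Fin n → ℂ) (hz : z ∈ U)
    (f : A2 U) : evalL hU z hz f = hol f z :=
  rfl

theorem fderiv_hol_sub {U : Set (Fin n → ℂ)} (hU : IsOpen U) (f g : A2 U) {z : Fin n → ℂ}
    (hz : z ∈ U) :
    fderiv ℂ (hol f) z - fderiv ℂ (hol g) z = fderiv ℂ (hol (f - g)) z := by
  have h : hol (f - g) = hol f - hol g := funext fun w => hol_sub hU f g w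
  rw [h, fderiv_sub ((differentiableOn_hol f).differentiableAt (hU.mem_nhds hz))
    ((differentiableOn_hol g).differentiableAt (hU.mem_nhds hz))]

/-- The gradient estimate applied to `F k - F l` makes the derivatives uniformly Cauchy near each
point, so differentiability survives the pointwise limit. -/
theorem exists_hol_limit {U : Set (Fin n → ℂ)} (hU : IsOpen U) {F : ℕ → A2 U}
    (hF : CauchySeq F) : ∃ g : (Fin n → ℂ) → ℂ, DifferentiableOn ℂ g U ∧
      ∀ z ∈ U, Tendsto (fun k => hol (F k) z) atTop (𝓝 (g z)) := by
  have hex : ∀ z, ∃ a, z ∈ U → Tendsto (fun k => hol (F k) z) atTop (𝓝 a) := by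
    intro z
    by_cases hz : z ∈ U
    · obtain ⟨a, ha⟩ := cauchySeq_tendsto_of_complete
        ((evalL hU z hz).uniformContinuous.comp_cauchySeq hF)
      exact ⟨a, fun _ => ha⟩
    · exact ⟨0, fun h => absurd h hz⟩
  choose g hg using hex
  refine ⟨g, fun z₀ hz₀ => ?_, hg⟩
  obtain ⟨r, hr, hzr⟩ := exists_closedBall_three_subset hU hz₀
  have hsub : Metric.ball z₀ (r / 2) ⊆ U :=
    (Metric.ball_subset_closedBall.trans
      (Metric.closedBall_subset_closedBall (by linarith))).trans hzr
  set C := 2 * ballConst n r / r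
  have hC : 0 ≤ C := by have := ballConst_nonneg n r; positivity
  have hcauchy : UniformCauchySeqOn (fun k => fderiv ℂ (hol (F k))) atTop
      (Metric.ball z₀ (r / 2)) := by
    rw [Metric.uniformCauchySeqOn_iff]
    intro ε hε
    obtain ⟨N, hN⟩ := Metric.cauchySeq_iff.1 hF (ε / (C + 1)) (by positivity)
    refine ⟨N, fun k hk l hl w hw => ?_⟩
    rw [dist_eq_norm, fderiv_hol_sub hU _ _ (hsub hw)]
    refine (norm_fderiv_hol_le hU (F k - F l) hr hzr hw).trans_lt ?_
    have h1 := hN k hk l hl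
    rw [dist_eq_norm, lt_div_iff₀ (by positivity)] at h1
    nlinarith [norm_nonneg (F k - F l)]
  have hex' : ∀ w, ∃ a, w ∈ Metric.ball z₀ (r / 2) →
      Tendsto (fun k => fderiv ℂ (hol (F k)) w) atTop (𝓝 a) := by
    intro w
    by_cases hw : w ∈ Metric.ball z₀ (r / 2)
    · obtain ⟨a, ha⟩ := cauchySeq_tendsto_of_complete (hcauchy.cauchySeq hw)
      exact ⟨a, fun _ => ha⟩
    · exact ⟨0, fun h => absurd h hw⟩
  choose g' hg' using hex'
  have hunif := hcauchy.tendstoUniformlyOn_of_tendsto hg'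
  have hd := hasFDerivAt_of_tendstoUniformlyOn Metric.isOpen_ball hunif
    (fun k w hw => ((differentiableOn_hol (F k)).differentiableAt
      (hU.mem_nhds (hsub hw))).hasFDerivAt) (fun w hw => hg w (hsub hw))
    (Metric.mem_ball_self (half_pos hr))
  exact hd.differentiableAt.differentiableWithinAt

/-- An almost everywhere convergent subsequence identifies the `L²` limit with the holomorphic
pointwise limit. -/
theorem isClosed_A2 {U : Set (Fin n → ℂ)} (hU : IsOpen U) :
    IsClosed (A2 U : Set (Lp ℂ 2 (volume.restrict U))) := by
  refine IsSeqClosed.isClosed fun x f hx hlim => ?_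
  let F : ℕ → A2 U := fun k => ⟨x k, hx k⟩
  have hF : CauchySeq F := by
    have hx' := hlim.cauchySeq
    rw [Metric.cauchySeq_iff] at hx' ⊢
    exact hx'
  obtain ⟨g, hg, hlimg⟩ := exists_hol_limit hU hF
  refine ⟨g, hg, ?_⟩
  obtain ⟨ns, hns, hae⟩ := (tendstoInMeasure_of_tendsto_Lp hlim).exists_seq_tendsto_ae
  have hall : ∀ᵐ z ∂(volume.restrict U), ∀ k, (x k : (Fin n → ℂ) → ℂ) z = hol (F k) z :=
    ae_all_iff.2 fun k => coeFn_ae_eq_hol hU (F k)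
  filter_upwards [hae, hall, ae_restrict_mem hU.measurableSet] with z h1 h2 hz
  simp only [h2] at h1
  exact tendsto_nhds_unique h1 ((hlimg z hz).comp hns.tendsto_atTop)

theorem completeSpace_A2 {U : Set (Fin n → ℂ)} (hU : IsOpen U) : CompleteSpace (A2 U) :=
  (isClosed_A2 hU).completeSpace_coe

theorem inner_kernelFun {U : Set (Fin n → ℂ)} (hU : IsOpen U) {z : Fin n → ℂ} (hz : z ∈ U)
    (f : A2 U) : inner ℂ (kernelFun U z) f = hol f z := by
  have := completeSpace_A2 hU
  have h : ∃ k : A2 U, IsReproducing U z k :=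
    ⟨(InnerProductSpace.toDual ℂ (A2 U)).symm (evalL hU z hz), fun f => by
      rw [InnerProductSpace.toDual_symm_apply, evalL_apply]⟩
  rw [kernelFun, dif_pos h]
  exact h.choose_spec f

theorem bergmanKernel_eq_inner {U : Set (Fin n → ℂ)} (hU : IsOpen U) {z w : Fin n → ℂ}
    (hw : w ∈ U) : bergmanKernel U w z = inner ℂ (kernelFun U w) (kernelFun U z) :=
  (inner_kernelFun hU hw _).symm

theorem inner_self_eq_ofReal {H : Type*} [NormedAddCommGroup H]
    [InnerProductSpace ℂ H] (x : H) : inner ℂ x x = ((‖x‖ ^ 2 : ℝ) : ℂ) := by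
  rw [inner_self_eq_norm_sq_to_K]
  push_cast
  rfl

theorem bergmanKernel_self {U : Set (Fin n → ℂ)} (hU : IsOpen U) {z : Fin n → ℂ}
    (hz : z ∈ U) : bergmanKernel U z z = ((‖kernelFun U z‖ ^ 2 : ℝ) : ℂ) := by
  rw [bergmanKernel_eq_inner hU hz]
  exact inner_self_eq_ofReal _

theorem bergmanKernel_conj {U : Set (Fin n → ℂ)} (hU : IsOpen U) {z w : Fin n → ℂ}
    (hz : z ∈ U) (hw : w ∈ U) :
    bergmanKernel U z w = starRingEnd ℂ (bergmanKernel U w z) := by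
  rw [bergmanKernel_eq_inner hU hz, bergmanKernel_eq_inner hU hw]
  exact (inner_conj_symm (𝕜 := ℂ) (kernelFun U z) (kernelFun U w)).symm

theorem norm_le_of_forall_norm_inner_le {H : Type*} [NormedAddCommGroup H]
    [InnerProductSpace ℂ H] {x : H} {M : ℝ} (hM : 0 ≤ M)
    (h : ∀ f : H, ‖inner ℂ x f‖ ≤ M * ‖f‖) : ‖x‖ ≤ M := by
  have hx := h x
  rw [inner_self_eq_norm_sq_to_K, norm_pow, RCLike.norm_ofReal, abs_norm, sq] at hx
  rcases eq_or_lt_of_le (norm_nonneg x) with h0 | h0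
  · rwa [← h0]
  · exact le_of_mul_le_mul_right hx h0

/-- Dual to the Lipschitz estimate: pairing `K_z - K_w` with `f` gives `f(z) - f(w)`. -/
theorem norm_kernelFun_sub_le {U : Set (Fin n → ℂ)} (hU : IsOpen U)
    {z₀ z w : Fin n → ℂ} {r : ℝ} (hr : 0 < r) (hzr : Metric.closedBall z₀ (3 * r) ⊆ U)
    (hz : z ∈ Metric.ball z₀ (r / 2)) (hw : w ∈ Metric.ball z₀ (r / 2)) :
    ‖kernelFun U z - kernelFun U w‖ ≤ 2 * ballConst n r / r * dist z w := by
  have hsub : Metric.ball z₀ (r / 2) ⊆ U :=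
    (Metric.ball_subset_closedBall.trans
      (Metric.closedBall_subset_closedBall (by linarith))).trans hzr
  refine norm_le_of_forall_norm_inner_le
    (by have := ballConst_nonneg n r; positivity) fun f => ?_
  rw [inner_sub_left, inner_kernelFun hU (hsub hz), inner_kernelFun hU (hsub hw)]
  exact norm_hol_sub_le hU f hr hzr hz hw

theorem continuousOn_kernelFun {U : Set (Fin n → ℂ)} (hU : IsOpen U) :
    ContinuousOn (kernelFun U) U := by
  intro z₀ hz₀
  obtain ⟨r, hr, hzr⟩ := exists_closedBall_three_subset hU hz₀
  refine ContinuousAt.continuousWithinAt ?_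
  have hlip : LipschitzOnWith (2 * ballConst n r / r).toNNReal (kernelFun U)
      (Metric.ball z₀ (r / 2)) := by
    refine LipschitzOnWith.of_dist_le_mul fun z hz w hw => ?_
    rw [dist_eq_norm, Real.coe_toNNReal _ (by have := ballConst_nonneg n r; positivity)]
    exact norm_kernelFun_sub_le hU hr hzr hz hw
  exact hlip.continuousOn.continuousAt (Metric.ball_mem_nhds _ (half_pos hr))

theorem normalizedKernel_eq {U : Set (Fin n → ℂ)} (hU : IsOpen U) {z : Fin n → ℂ}
    (hz : z ∈ U) :
    normalizedKernel U z = ((‖kernelFun U z‖ : ℂ))⁻¹ • kernelFun U z := by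
  rw [normalizedKernel, bergmanKernel_self hU hz, Complex.ofReal_re, Real.sqrt_sq (norm_nonneg _)]

theorem kernelFun_ne_zero_iff {U : Set (Fin n → ℂ)} (hU : IsOpen U) {z : Fin n → ℂ}
    (hz : z ∈ U) : kernelFun U z ≠ 0 ↔ bergmanKernel U z z ≠ 0 := by
  rw [bergmanKernel_self hU hz]
  simp

theorem norm_normalizedKernel_le {U : Set (Fin n → ℂ)} (hU : IsOpen U) {z : Fin n → ℂ}
    (hz : z ∈ U) : ‖normalizedKernel U z‖ ≤ 1 := by
  rw [normalizedKernel_eq hU hz, norm_smul, norm_inv, Complex.norm_real, norm_norm]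
  exact inv_mul_le_one

theorem mem_diff_zeroSet_iff {U : Set (Fin n → ℂ)} (hU : IsOpen U) {z : Fin n → ℂ} :
    z ∈ U \ zeroSet U ↔ z ∈ U ∧ kernelFun U z ≠ 0 := by
  constructor
  · rintro ⟨h1, h2⟩
    exact ⟨h1, (kernelFun_ne_zero_iff hU h1).2 fun h => h2 ⟨h1, h⟩⟩
  · rintro ⟨h1, h2⟩
    exact ⟨h1, fun h => (kernelFun_ne_zero_iff hU h1).1 h2 h.2⟩

theorem isOpen_diff_zeroSet {U : Set (Fin n → ℂ)} (hU : IsOpen U) :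
    IsOpen (U \ zeroSet U) := by
  have h : U \ zeroSet U = U ∩ kernelFun U ⁻¹' {0}ᶜ := by
    ext z
    rw [mem_diff_zeroSet_iff hU]
    rfl
  rw [h]
  exact (continuousOn_kernelFun hU).isOpen_inter_preimage hU isOpen_compl_singleton

theorem continuousOn_normalizedKernel {U : Set (Fin n → ℂ)} (hU : IsOpen U) :
    ContinuousOn (normalizedKernel U) (U \ zeroSet U) := by
  have hK : ContinuousOn (kernelFun U) (U \ zeroSet U) :=
    (continuousOn_kernelFun hU).mono sdiff_subset
  refine ContinuousOn.congr (f := fun z => ((‖kernelFun U z‖ : ℂ))⁻¹ • kernelFun U z) ?_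
    fun z hz => normalizedKernel_eq hU hz.1
  have h0 : ContinuousOn (fun z => (‖kernelFun U z‖ : ℂ)) (U \ zeroSet U) :=
    Complex.continuous_ofReal.comp_continuousOn hK.norm
  refine ContinuousOn.smul (h0.inv₀ ?_) hK
  intro z hz
  simpa using ((mem_diff_zeroSet_iff hU).1 hz).2

theorem continuousOn_berezin {U : Set (Fin n → ℂ)} (hU : IsOpen U) (T : A2 U →L[ℂ] A2 U) :
    ContinuousOn (berezin T) (U \ zeroSet U) :=
  (continuousOn_normalizedKernel hU).inner
    (T.continuous.comp_continuousOn (continuousOn_normalizedKernel hU))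

/-! ### Extension by zero, multiplication and Toeplitz operators -/

theorem indicator_hol {U : Set (Fin n → ℂ)} (f : A2 U) : U.indicator (hol f) = hol f := by
  ext z
  by_cases hz : z ∈ U
  · rw [indicator_of_mem hz]
  · rw [indicator_of_notMem hz, hol_of_notMem f hz]

theorem memLp_hol_restrict {U : Set (Fin n → ℂ)} (hU : IsOpen U) (f : A2 U) :
    MemLp (hol f) 2 (volume.restrict U) :=
  (memLp_congr_ae (coeFn_ae_eq_hol hU f)).1 (Lp.memLp _)

theorem memLp_hol {U : Set (Fin n → ℂ)} (hU : IsOpen U) (f : A2 U) :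
    MemLp (hol f) 2 volume := by
  rw [← indicator_hol, memLp_indicator_iff_restrict hU.measurableSet]
  exact memLp_hol_restrict hU f

theorem norm_eq_eLpNorm_hol {U : Set (Fin n → ℂ)} (hU : IsOpen U) (f : A2 U) :
    ‖f‖ = (eLpNorm (hol f) 2 volume).toReal := by
  rw [← indicator_hol, eLpNorm_indicator_eq_eLpNorm_restrict hU.measurableSet,
    ← eLpNorm_congr_ae (coeFn_ae_eq_hol hU f)]
  rfl

/-- Extension by zero, as an isometry from `A²(U)` to `L²(ℂⁿ)`. -/
def extendL {U : Set (Fin n → ℂ)} (hU : IsOpen U) :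
    A2 U →ₗᵢ[ℂ] Lp ℂ 2 (volume : Measure (Fin n → ℂ)) where
  toFun f := (memLp_hol hU f).toLp (hol f)
  map_add' f g := by
    rw [← MemLp.toLp_add]
    exact MemLp.toLp_congr _ _ (ae_of_all _ fun z => hol_add hU f g z)
  map_smul' c f := by
    rw [RingHom.id_apply, ← MemLp.toLp_const_smul]
    exact MemLp.toLp_congr _ _ (ae_of_all _ fun z => hol_smul hU c f z)
  norm_map' f := by
    rw [norm_eq_eLpNorm_hol hU f]
    exact Lp.norm_toLp _ (memLp_hol hU f)

theorem coeFn_extendL {U : Set (Fin n → ℂ)} (hU : IsOpen U) (f : A2 U) :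
    extendL hU f =ᵐ[volume] hol f :=
  MemLp.coeFn_toLp (memLp_hol hU f)

theorem inner_extendL {U : Set (Fin n → ℂ)} (hU : IsOpen U) (f g : A2 U) :
    inner ℂ (extendL hU f) (extendL hU g) = inner ℂ f g :=
  (extendL hU).inner_map_map f g

/-- The orthogonal projection from `L²(ℂⁿ)` onto `A²(U)`, the adjoint of `extendL`. -/
def projL {U : Set (Fin n → ℂ)} (hU : IsOpen U) :
    Lp ℂ 2 (volume : Measure (Fin n → ℂ)) →L[ℂ] A2 U :=
  haveI := completeSpace_A2 hU
  (extendL hU).toContinuousLinearMap.adjoint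

theorem inner_projL {U : Set (Fin n → ℂ)} (hU : IsOpen U) (f : A2 U)
    (x : Lp ℂ 2 (volume : Measure (Fin n → ℂ))) :
    inner ℂ f (projL hU x) = inner ℂ (extendL hU f) x := by
  have := completeSpace_A2 hU
  exact ContinuousLinearMap.adjoint_inner_right _ _ _

theorem norm_projL_le {U : Set (Fin n → ℂ)} (hU : IsOpen U)
    (x : Lp ℂ 2 (volume : Measure (Fin n → ℂ))) : ‖projL hU x‖ ≤ ‖x‖ := by
  refine norm_le_of_forall_norm_inner_le (norm_nonneg _) fun f => ?_
  rw [← norm_inner_symm (𝕜 := ℂ) f (projL hU x), inner_projL, mul_comm,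
    ← (extendL hU).norm_map f]
  exact norm_inner_le_norm _ _

/-- Multiplication by a bounded function on `L²(ℂⁿ)`. -/
def mulL {ψ : (Fin n → ℂ) → ℂ} (hψ : MemLp ψ ∞ volume) :
    Lp ℂ 2 (volume : Measure (Fin n → ℂ)) →L[ℂ] Lp ℂ 2 (volume : Measure (Fin n → ℂ)) :=
  (ContinuousLinearMap.mul ℂ ℂ).holderL volume ∞ 2 2 (hψ.toLp ψ)

theorem coeFn_mulL {ψ : (Fin n → ℂ) → ℂ} (hψ : MemLp ψ ∞ volume)
    (x : Lp ℂ 2 (volume : Measure (Fin n → ℂ))) :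
    mulL hψ x =ᵐ[volume] fun z => ψ z * x z := by
  have h : mulL hψ x =ᵐ[volume] fun z => hψ.toLp ψ z * x z :=
    (ContinuousLinearMap.mul ℂ ℂ).coeFn_holder (r := 2) (hψ.toLp ψ) x
  filter_upwards [h, hψ.coeFn_toLp] with z h1 h2
  rw [h1, h2]

theorem inner_mulL {ψ : (Fin n → ℂ) → ℂ} (hψ : MemLp ψ ∞ volume)
    (x y : Lp ℂ 2 (volume : Measure (Fin n → ℂ))) {f g : (Fin n → ℂ) → ℂ}
    (hx : x =ᵐ[volume] f) (hy : y =ᵐ[volume] g) :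
    Integrable (fun z => starRingEnd ℂ (f z) * ψ z * g z) ∧
    inner ℂ x (mulL hψ y) = ∫ z, starRingEnd ℂ (f z) * ψ z * g z := by
  have h : (fun z => inner ℂ (x z) (mulL hψ y z)) =ᵐ[volume]
      fun z => starRingEnd ℂ (f z) * ψ z * g z := by
    filter_upwards [hx, hy, coeFn_mulL hψ y] with z h1 h2 h3
    rw [h3, h1, h2, RCLike.inner_apply]
    ring
  exact ⟨(L2.integrable_inner x (mulL hψ y)).congr h, by rw [L2.inner_def, integral_congr_ae h]⟩

/-- The Toeplitz operator on `A²(U)` with bounded symbol `ψ`. -/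
def toeplitz {U : Set (Fin n → ℂ)} (hU : IsOpen U) {ψ : (Fin n → ℂ) → ℂ}
    (hψ : MemLp ψ ∞ volume) : A2 U →L[ℂ] A2 U :=
  projL hU ∘L mulL hψ ∘L (extendL hU).toContinuousLinearMap

theorem inner_toeplitz {U : Set (Fin n → ℂ)} (hU : IsOpen U) {ψ : (Fin n → ℂ) → ℂ}
    (hψ : MemLp ψ ∞ volume) (f g : A2 U) :
    inner ℂ g (toeplitz hU hψ f) = inner ℂ (extendL hU g) (mulL hψ (extendL hU f)) :=
  inner_projL hU g _

theorem inner_toeplitz_eq_integral {U : Set (Fin n → ℂ)} (hU : IsOpen U) {ψ : (Fin n → ℂ) → ℂ}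
    (hψ : MemLp ψ ∞ volume) (f g : A2 U) :
    Integrable (fun z => starRingEnd ℂ (hol g z) * ψ z * hol f z) ∧
    inner ℂ g (toeplitz hU hψ f) = ∫ z, starRingEnd ℂ (hol g z) * ψ z * hol f z := by
  rw [inner_toeplitz]
  exact inner_mulL hψ _ _ (coeFn_extendL hU g) (coeFn_extendL hU f)

theorem isToeplitz_toeplitz {U : Set (Fin n → ℂ)} (hU : IsOpen U) {ψ : (Fin n → ℂ) → ℂ}
    (hψ : MemLp ψ ∞ volume) : IsToeplitz U ψ (toeplitz hU hψ) := by
  have h : {f : A2 U | ToeplitzEq U ψ f (toeplitz hU hψ f)} = univ := by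
    refine eq_univ_of_forall fun f z hz => ?_
    obtain ⟨h1, h2⟩ := inner_toeplitz_eq_integral hU hψ f (kernelFun U z)
    have hE : EqOn (fun w => bergmanKernel U z w * ψ w * hol f w)
        (fun w => starRingEnd ℂ (hol (kernelFun U z) w) * ψ w * hol f w) U := by
      intro w hw
      simp only
      rw [bergmanKernel_conj hU hz hw]
      rfl
    refine ⟨h1.integrableOn.congr_fun hE.symm hU.measurableSet, ?_⟩
    rw [← inner_kernelFun hU hz, h2, setIntegral_congr_fun hU.measurableSet hE]
    refine (setIntegral_eq_integral_of_forall_compl_eq_zero fun w hw => ?_).symm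
    rw [hol_of_notMem f hw, mul_zero]
  rw [IsToeplitz, h]
  exact dense_univ

theorem berezin_toeplitz {U : Set (Fin n → ℂ)} (hU : IsOpen U) {ψ : (Fin n → ℂ) → ℂ}
    (hψ : MemLp ψ ∞ volume) (z : Fin n → ℂ) :
    berezin (toeplitz hU hψ) z = inner ℂ (extendL hU (normalizedKernel U z))
      (mulL hψ (extendL hU (normalizedKernel U z))) :=
  inner_toeplitz hU hψ _ _

theorem opNorm_le_of_forall_norm_inner_le {H : Type*} [NormedAddCommGroup H]
    [InnerProductSpace ℂ H] (T : H →L[ℂ] H) {M : ℝ} (hM : 0 ≤ M)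
    (h : ∀ f g : H, ‖inner ℂ g (T f)‖ ≤ M * ‖f‖ * ‖g‖) : ‖T‖ ≤ M := by
  refine T.opNorm_le_bound hM fun f => ?_
  refine norm_le_of_forall_norm_inner_le (by positivity) fun g => ?_
  rw [norm_inner_symm]
  exact h f g

/-- The Toeplitz operators whose symbol is bounded and supported in a compact subset of `U`. -/
def compactToeplitz {U : Set (Fin n → ℂ)} (hU : IsOpen U) : Submodule ℂ (A2 U →L[ℂ] A2 U) where
  carrier := {T | ∃ (ψ : (Fin n → ℂ) → ℂ) (hψ : MemLp ψ ∞ volume) (L : Set (Fin n → ℂ)),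
    IsCompact L ∧ L ⊆ U ∧ (∀ z ∉ L, ψ z = 0) ∧ T = toeplitz hU hψ}
  zero_mem' := by
    refine ⟨0, MemLp.zero, ∅, isCompact_empty, empty_subset _, fun _ _ => rfl, ?_⟩
    refine ContinuousLinearMap.ext fun f => ext_inner_left ℂ fun g => ?_
    rw [(inner_toeplitz_eq_integral hU _ f g).2]
    simp
  add_mem' := by
    rintro _ _ ⟨ψ₁, h₁, L₁, hc₁, hs₁, hz₁, rfl⟩ ⟨ψ₂, h₂, L₂, hc₂, hs₂, hz₂, rfl⟩
    refine ⟨ψ₁ + ψ₂, h₁.add h₂, L₁ ∪ L₂, hc₁.union hc₂, union_subset hs₁ hs₂, ?_, ?_⟩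
    · intro z hz
      rw [mem_union, not_or] at hz
      simp [hz₁ z hz.1, hz₂ z hz.2]
    · refine ContinuousLinearMap.ext fun f => ext_inner_left ℂ fun g => ?_
      rw [_root_.add_apply, inner_add_right]
      obtain ⟨i₁, e₁⟩ := inner_toeplitz_eq_integral hU h₁ f g
      obtain ⟨i₂, e₂⟩ := inner_toeplitz_eq_integral hU h₂ f g
      rw [e₁, e₂, (inner_toeplitz_eq_integral hU (h₁.add h₂) f g).2, ← integral_add i₁ i₂]
      refine integral_congr_ae (ae_of_all _ fun z => ?_)
      simp only [Pi.add_apply]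
      ring
  smul_mem' := by
    rintro c _ ⟨ψ, h, L, hc, hs, hz, rfl⟩
    refine ⟨c • ψ, h.const_smul c, L, hc, hs, fun z hzL => by simp [hz z hzL], ?_⟩
    refine ContinuousLinearMap.ext fun f => ext_inner_left ℂ fun g => ?_
    rw [_root_.smul_apply, inner_smul_right, (inner_toeplitz_eq_integral hU h f g).2,
      (inner_toeplitz_eq_integral hU (h.const_smul c) f g).2, ← integral_const_mul]
    refine integral_congr_ae (ae_of_all _ fun z => ?_)
    simp only [Pi.smul_apply, smul_eq_mul]
    ring

/-! ### Density of the Toeplitz operators -/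

/-- The Cauchy integral of a continuous `g` is analytic. It equals `g` because each functional `l i`
commutes with the integral and satisfies the scalar Cauchy formula, and the `l i` separate points.
-/
theorem analyticOnNhd_of_weak {X ι : Type*} [NormedAddCommGroup X] [NormedSpace ℂ X]
    [CompleteSpace X] {g : ℂ → X} {V : Set ℂ} (hV : IsOpen V) (hg : ContinuousOn g V)
    (l : ι → X →L[ℂ] ℂ) (hsep : ∀ x y, (∀ i, l i x = l i y) → x = y)
    (hd : ∀ i, DifferentiableOn ℂ (fun ζ => l i (g ζ)) V) : AnalyticOnNhd ℂ g V := by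
  intro c hc
  obtain ⟨R, hR, hRV⟩ := Metric.nhds_basis_closedBall.mem_iff.1 (hV.mem_nhds hc)
  lift R to NNReal using hR.le
  have hR0 : 0 < R := by exact_mod_cast hR
  have hsph : ContinuousOn g (Metric.sphere c R) :=
    hg.mono (Metric.sphere_subset_closedBall.trans hRV)
  have hps := hasFPowerSeriesOn_cauchy_integral (hsph.circleIntegrable R.coe_nonneg) hR0
  refine hps.analyticAt.congr ?_
  filter_upwards [Metric.ball_mem_nhds c hR] with w hw
  refine hsep _ _ fun i => ?_
  have hne : ∀ z ∈ Metric.sphere c (R : ℝ), z - w ≠ 0 := by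
    intro z hz h
    rw [sub_eq_zero] at h
    rw [h, Metric.mem_sphere] at hz
    rw [Metric.mem_ball, hz] at hw
    exact lt_irrefl _ hw
  have hint : CircleIntegrable (fun z => (z - w)⁻¹ • g z) c R :=
    ContinuousOn.circleIntegrable R.coe_nonneg
      (((continuousOn_id.sub continuousOn_const).inv₀ hne).smul hsph)
  have hcomm : l i (∮ z in C(c, R), (z - w)⁻¹ • g z) = ∮ z in C(c, R), (z - w)⁻¹ • l i (g z) := by
    unfold circleIntegral
    rw [← ContinuousLinearMap.intervalIntegral_comp_comm _ hint.out]
    simp only [map_smul]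
  rw [map_smul, hcomm]
  exact Complex.two_pi_I_inv_smul_circleIntegral_sub_inv_smul_of_differentiable_on_off_countable
    countable_empty hw ((hd i).continuousOn.mono hRV) fun z hz =>
      (hd i).differentiableAt (hV.mem_nhds (hRV (Metric.ball_subset_closedBall hz.1)))

/-- Identity theorem in the quotient by `W`: the class of `g` vanishes at real points, which
accumulate at `0`. -/
theorem mem_of_forall_real_mem {X : Type*} [NormedAddCommGroup X] [NormedSpace ℂ X]
    {W : Submodule ℂ X} (hW : IsClosed (W : Set X)) {g : ℂ → X} {V : Set ℂ}
    (hV : IsOpen V) (hVc : IsPreconnected V) (h0 : 0 ∈ V) (hg : AnalyticOnNhd ℂ g V)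
    (hreal : ∀ t : ℝ, (t : ℂ) ∈ V → g t ∈ W) {ζ : ℂ} (hζ : ζ ∈ V) : g ζ ∈ W := by
  have hW' : IsClosed (W : Set X) := hW
  have hF : AnalyticOnNhd ℂ (fun ζ => W.mkQL (g ζ)) V := W.mkQL.comp_analyticOnNhd hg
  have hfreq : ∃ᶠ z in 𝓝[≠] (0 : ℂ), W.mkQL (g z) = 0 := by
    have ht : Tendsto (fun t : ℝ => (t : ℂ)) (𝓝[≠] 0) (𝓝[≠] 0) := by
      refine tendsto_nhdsWithin_iff.2 ⟨?_, ?_⟩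
      · exact tendsto_nhdsWithin_of_tendsto_nhds
          (by simpa using Complex.continuous_ofReal.tendsto (0 : ℝ))
      · filter_upwards [self_mem_nhdsWithin] with t ht
        simpa using ht
    refine ht.frequently (Eventually.frequently ?_)
    filter_upwards [ht (mem_nhdsWithin_of_mem_nhds (hV.mem_nhds h0))] with t htV
    rw [Submodule.mkQL_apply, Submodule.mkQ_apply, Submodule.Quotient.mk_eq_zero]
    exact hreal t htV
  have h := hF.eqOn_zero_of_preconnected_of_frequently_eq_zero hVc h0 hfreq hζ
  simpa using h

theorem setOf_line_mem_ball_convex {E : Type*} [NormedAddCommGroup E] [NormedSpace ℂ E]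
    (c p q : E) (r : ℝ) : Convex ℝ {ζ : ℂ | p + ζ • q ∈ Metric.ball c r} := by
  have h : {ζ : ℂ | p + ζ • q ∈ Metric.ball c r}
      = (LinearMap.toSpanSingleton ℂ E q).restrictScalars ℝ ⁻¹'
        ((fun x => p + x) ⁻¹' Metric.ball c r) := rfl
  rw [h]
  exact ((convex_ball c r).translate_preimage_right p).linear_preimage _

theorem continuous_rankOne {H : Type*} [NormedAddCommGroup H] [InnerProductSpace ℂ H] :
    Continuous fun p : H × H => InnerProductSpace.rankOne ℂ p.1 p.2 := by
  simp only [InnerProductSpace.rankOne_def]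
  exact ((ContinuousLinearMap.smulRightL ℂ H H).continuous.comp
    ((innerSL ℂ).continuous.comp continuous_snd)).clm_apply continuous_fst

/-- Tested on matrix entries, which factor as `⟨x, u⟩ ⟨v, y⟩`. The conjugate in `hud` reflects that
the operator is linear in `u` but conjugate linear in `v`. -/
theorem analyticOnNhd_rankOne {H : Type*} [NormedAddCommGroup H] [InnerProductSpace ℂ H]
    [CompleteSpace H] {u v : ℂ → H} {V : Set ℂ} (hV : IsOpen V) (hu : ContinuousOn u V)
    (hv : ContinuousOn v V)
    (hud : ∀ x, DifferentiableOn ℂ (fun ζ => starRingEnd ℂ (inner ℂ (u ζ) x)) V)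
    (hvd : ∀ y, DifferentiableOn ℂ (fun ζ => inner ℂ (v ζ) y) V) :
    AnalyticOnNhd ℂ (fun ζ => InnerProductSpace.rankOne ℂ (u ζ) (v ζ)) V := by
  have hc : ContinuousOn (fun ζ => InnerProductSpace.rankOne ℂ (u ζ) (v ζ)) V :=
    ContinuousOn.congr (Continuous.comp_continuousOn continuous_rankOne (hu.prodMk hv))
      fun _ _ => rfl
  refine analyticOnNhd_of_weak hV hc
    (fun xy : H × H => (innerSL ℂ xy.1) ∘L (ContinuousLinearMap.apply ℂ H xy.2)) ?_ ?_
  · exact fun S T h => ContinuousLinearMap.ext fun f => ext_inner_left ℂ fun x => h (x, f)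
  · rintro ⟨x, y⟩
    refine ((hud x).mul (hvd y)).congr fun ζ _ => ?_
    rw [ContinuousLinearMap.comp_apply, ContinuousLinearMap.apply_apply, innerSL_apply_apply,
      InnerProductSpace.inner_right_rankOne_apply, ← inner_conj_symm x (u ζ)]
    rfl

/-- Polarization by analytic continuation: `ζ ↦ k (p + ζ̄ q) ⊗ k (p + ζ q)` is holomorphic, diagonal
for real `ζ`, and equal to `k a ⊗ k b` at `ζ = i` for suitable `p`, `q`. -/
theorem rankOne_mem_of_forall_rankOne_self_mem {E H : Type*} [NormedAddCommGroup E]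
    [NormedSpace ℂ E] [NormedAddCommGroup H] [InnerProductSpace ℂ H] [CompleteSpace H]
    {k : E → H} {c : E} {r : ℝ} (hk : ContinuousOn k (Metric.ball c r))
    (hhol : ∀ x, DifferentiableOn ℂ (fun z => inner ℂ (k z) x) (Metric.ball c r))
    {W : Submodule ℂ (H →L[ℂ] H)} (hW : IsClosed (W : Set (H →L[ℂ] H)))
    (hself : ∀ z ∈ Metric.ball c r, InnerProductSpace.rankOne ℂ (k z) (k z) ∈ W)
    {a b : E} (ha : a ∈ Metric.ball c r) (hb : b ∈ Metric.ball c r) :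
    InnerProductSpace.rankOne ℂ (k a) (k b) ∈ W := by
  -- The midpoint `p = (a + b) / 2` and `q = (b - a) / (2i)`.
  obtain ⟨p, q, haq, hbq⟩ : ∃ p q : E, p + (starRingEnd ℂ Complex.I) • q = a ∧
      p + Complex.I • q = b := by
    have hIq : Complex.I • ((2 * Complex.I)⁻¹ • (b - a)) = (2⁻¹ : ℂ) • (b - a) := by
      rw [smul_smul]
      congr 1
      field_simp
    refine ⟨(2⁻¹ : ℂ) • (a + b), (2 * Complex.I)⁻¹ • (b - a), ?_, ?_⟩
    · rw [Complex.conj_I, neg_smul, hIq]; module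
    · rw [hIq]; module
  have hV₁ : Convex ℝ {ζ : ℂ | p + ζ • q ∈ Metric.ball c r} := setOf_line_mem_ball_convex c p q r
  have hline : Continuous fun ζ : ℂ => p + ζ • q := by fun_prop
  have hV₁o : IsOpen {ζ : ℂ | p + ζ • q ∈ Metric.ball c r} := Metric.isOpen_ball.preimage hline
  have hmem₁ : ∀ ζ ∈ {ζ : ℂ | p + ζ • q ∈ Metric.ball c r}, p + ζ • q ∈ Metric.ball c r :=
    fun _ h => h
  have hIV₁ : Complex.I ∈ {ζ : ℂ | p + ζ • q ∈ Metric.ball c r} := by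
    change p + Complex.I • q ∈ Metric.ball c r
    rwa [hbq]
  have hIV₁' : starRingEnd ℂ Complex.I ∈ {ζ : ℂ | p + ζ • q ∈ Metric.ball c r} := by
    change p + (starRingEnd ℂ Complex.I) • q ∈ Metric.ball c r
    rwa [haq]
  generalize {ζ : ℂ | p + ζ • q ∈ Metric.ball c r} = V₁ at *
  have hVo : IsOpen (V₁ ∩ (starRingEnd ℂ) ⁻¹' V₁) :=
    hV₁o.inter (hV₁o.preimage Complex.continuous_conj)
  have hVc : Convex ℝ (V₁ ∩ (starRingEnd ℂ) ⁻¹' V₁) :=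
    hV₁.inter (hV₁.linear_preimage Complex.conjAe.toLinearMap)
  -- `0` is the midpoint of `i` and `-i`.
  have h0V₁ : (0 : ℂ) ∈ V₁ := by
    have h := hV₁ hIV₁ hIV₁' (a := 2⁻¹) (b := 2⁻¹) (by norm_num) (by norm_num) (by norm_num)
    simpa using h
  have h0V : (0 : ℂ) ∈ V₁ ∩ (starRingEnd ℂ) ⁻¹' V₁ := ⟨h0V₁, by simpa using h0V₁⟩
  have hholV : ∀ x, DifferentiableOn ℂ (fun ζ : ℂ => inner ℂ (k (p + ζ • q)) x) V₁ := by
    intro x ζ hζ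
    have h1 : DifferentiableAt ℂ (fun z => inner ℂ (k z) x) (p + ζ • q) :=
      (hhol x).differentiableAt (Metric.isOpen_ball.mem_nhds (hmem₁ ζ hζ))
    exact (DifferentiableAt.comp (f := fun ζ : ℂ => p + ζ • q) ζ h1
      (by fun_prop)).differentiableWithinAt
  have k1 : ContinuousOn (fun ζ : ℂ => k (p + ζ • q)) (V₁ ∩ (starRingEnd ℂ) ⁻¹' V₁) :=
    hk.comp hline.continuousOn fun ζ hζ => hmem₁ ζ hζ.1
  have k2 : ContinuousOn (fun ζ : ℂ => k (p + (starRingEnd ℂ ζ) • q))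
      (V₁ ∩ (starRingEnd ℂ) ⁻¹' V₁) :=
    hk.comp (hline.comp Complex.continuous_conj).continuousOn fun ζ hζ => hmem₁ _ hζ.2
  -- The conjugated parameter goes into the linear slot, where it cancels the conjugate holomorphy
  -- of `k`.
  have hga := analyticOnNhd_rankOne hVo k2 k1 (fun x ζ hζ => by
      have h1 := ((hholV x).differentiableAt (hV₁o.mem_nhds hζ.2)).star_conj
      rw [Complex.conj_conj] at h1
      exact h1.differentiableWithinAt)
    fun y => (hholV y).mono inter_subset_left
  have hmem := mem_of_forall_real_mem hW hVo hVc.isPreconnected h0V hga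
    (fun t ht => by
      rw [Complex.conj_ofReal]
      exact hself _ (hmem₁ _ ht.1)) (ζ := Complex.I) ⟨hIV₁, hIV₁'⟩
  rwa [haq, hbq] at hmem

/-- The rank one operator is additive, homogeneous up to conjugation and continuous in each slot, so
density is used one slot at a time. -/
theorem rankOne_mem_of_span_dense {H : Type*} [NormedAddCommGroup H] [InnerProductSpace ℂ H]
    {S : Set H} (hS : (Submodule.span ℂ S).topologicalClosure = ⊤)
    {W : Submodule ℂ (H →L[ℂ] H)} (hW : IsClosed (W : Set (H →L[ℂ] H)))
    (h : ∀ a ∈ S, ∀ b ∈ S, InnerProductSpace.rankOne ℂ a b ∈ W) (x y : H) :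
    InnerProductSpace.rankOne ℂ x y ∈ W := by
  have hy : ∀ a ∈ S, InnerProductSpace.rankOne ℂ a y ∈ W := by
    intro a ha
    have hle : (Submodule.span ℂ S).topologicalClosure
        ≤ W.comap (InnerProductSpace.rankOne ℂ a).toLinearMap :=
      Submodule.topologicalClosure_minimal _ (Submodule.span_le.2 fun b hb => h a ha b hb)
        (hW.preimage (InnerProductSpace.rankOne ℂ a).continuous)
    rw [hS] at hle
    exact hle trivial
  let R : H →ₗ[ℂ] (H →L[ℂ] H) :=
    { toFun := fun x => InnerProductSpace.rankOne ℂ x y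
      map_add' := fun x x' => by rw [map_add]; rfl
      map_smul' := fun k x => by rw [map_smul]; rfl }
  have hRc : Continuous R :=
    continuous_rankOne.comp (continuous_id.prodMk continuous_const)
  have hle : (Submodule.span ℂ S).topologicalClosure ≤ W.comap R :=
    Submodule.topologicalClosure_minimal _ (Submodule.span_le.2 hy) (hW.preimage hRc)
  rw [hS] at hle
  exact hle trivial

theorem exists_finiteDimensional_near {H : Type*} [NormedAddCommGroup H]
    [InnerProductSpace ℂ H] {C : Set H} (hC : IsCompact C) {ε : ℝ} (hε : 0 < ε) :
    ∃ V : Submodule ℂ H, FiniteDimensional ℂ V ∧ ∀ x ∈ C, ∃ v ∈ V, ‖x - v‖ < ε := by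
  obtain ⟨t, ht, hcov⟩ := Metric.totallyBounded_iff.1 hC.totallyBounded ε hε
  refine ⟨Submodule.span ℂ t, FiniteDimensional.span_of_finite ℂ ht, fun x hx => ?_⟩
  obtain ⟨v, hv, hxv⟩ := mem_iUnion₂.1 (hcov hx)
  exact ⟨v, Submodule.subset_span hv, by rwa [← dist_eq_norm]⟩

/-- Approximation of a bounded operator by the elements of a subspace `𝒯` of operators whose
closure contains the rank one operators `k_z ⊗ k_z^*`, for a conjugate holomorphic family `k_z`
spanning a dense subspace. -/
theorem exists_approx_of_holomorphic_family {E H : Type*} [NormedAddCommGroup E]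
    [NormedSpace ℂ E] [NormedAddCommGroup H] [InnerProductSpace ℂ H] [CompleteSpace H]
    {k : E → H} {c : E} {r : ℝ} (hk : ContinuousOn k (Metric.ball c r))
    (hhol : ∀ x, DifferentiableOn ℂ (fun z => inner ℂ (k z) x) (Metric.ball c r))
    (hdense : ∀ x, (∀ z ∈ Metric.ball c r, inner ℂ (k z) x = 0) → x = 0)
    (𝒯 : Submodule ℂ (H →L[ℂ] H))
    (hself : ∀ z ∈ Metric.ball c r, ∀ ε > 0, ∃ S ∈ 𝒯, ∀ f g,
      ‖inner ℂ g (S f) - inner ℂ g (k z) * inner ℂ (k z) f‖ ≤ ε * ‖f‖ * ‖g‖)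
    (T : H →L[ℂ] H) {C : Set H} (hC : IsCompact C) {ε : ℝ} (hε : 0 < ε) :
    ∃ S ∈ 𝒯, (∀ f, ‖inner ℂ f (S f)‖ ≤ (‖T‖ + ε) * ‖f‖ ^ 2) ∧
      ∀ x ∈ C, ‖x‖ ≤ 1 → ‖inner ℂ x (S x) - inner ℂ x (T x)‖ ≤ ε := by
  have hW := Submodule.isClosed_topologicalClosure 𝒯
  have hself' : ∀ z ∈ Metric.ball c r,
      InnerProductSpace.rankOne ℂ (k z) (k z) ∈ 𝒯.topologicalClosure := by
    refine fun z hz => Metric.mem_closure_iff.2 fun δ hδ => ?_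
    obtain ⟨S, hS, hSle⟩ := hself z hz (δ / 2) (half_pos hδ)
    refine ⟨S, hS, ?_⟩
    rw [dist_comm, dist_eq_norm]
    refine (opNorm_le_of_forall_norm_inner_le _ (half_pos hδ).le fun f g => ?_).trans_lt
      (half_lt_self hδ)
    rw [_root_.sub_apply, inner_sub_right, InnerProductSpace.inner_right_rankOne_apply]
    exact hSle f g
  have hspan : (Submodule.span ℂ (k '' Metric.ball c r)).topologicalClosure = ⊤ := by
    rw [Submodule.topologicalClosure_eq_top_iff, Submodule.eq_bot_iff]
    exact fun x hx => hdense x fun z hz =>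
      hx _ (Submodule.subset_span (mem_image_of_mem _ hz))
  have hrank : ∀ x y, InnerProductSpace.rankOne ℂ x y ∈ 𝒯.topologicalClosure := by
    refine rankOne_mem_of_span_dense hspan hW ?_
    rintro _ ⟨a, ha, rfl⟩ _ ⟨b, hb, rfl⟩
    exact rankOne_mem_of_forall_rankOne_self_mem hk hhol hW hself' ha hb
  -- Chosen so that `‖T‖ * δ ≤ ε / 2`; half of `ε` is kept for the distance from `S` to `T P_V`.
  set δ : ℝ := ε / 2 / (‖T‖ + 1) with hδ
  have hδ0 : 0 < δ := by positivity
  obtain ⟨V, hVfin, hV⟩ := exists_finiteDimensional_near hC hδ0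
  -- In an orthonormal basis `e_i` of `V`, `T P_V` is the finite sum of the `T e_i ⊗ e_i`.
  have hTV : T ∘L V.starProjection ∈ 𝒯.topologicalClosure := by
    rw [(stdOrthonormalBasis ℂ V).starProjection_eq_sum_rankOne,
      ContinuousLinearMap.comp_finsetSum]
    refine Submodule.sum_mem _ fun i _ => ?_
    rw [InnerProductSpace.comp_rankOne]
    exact hrank _ _
  obtain ⟨S, hS, hSle⟩ := Metric.mem_closure_iff.1 hTV (ε / 2) (half_pos hε)
  rw [dist_comm, dist_eq_norm] at hSle
  have hnear : ∀ f, ‖inner ℂ f (S f) - inner ℂ f (T (V.starProjection f))‖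
      ≤ ε / 2 * ‖f‖ ^ 2 := by
    intro f
    rw [← inner_sub_right]
    refine (norm_inner_le_norm _ _).trans ?_
    have h1 := (S - T ∘L V.starProjection).le_of_opNorm_le hSle.le f
    rw [_root_.sub_apply, ContinuousLinearMap.comp_apply] at h1
    nlinarith [norm_nonneg f]
  refine ⟨S, hS, fun f => ?_, fun x hx hx1 => ?_⟩
  · have h1 : ‖inner ℂ f (T (V.starProjection f))‖ ≤ ‖T‖ * ‖f‖ ^ 2 := by
      refine (norm_inner_le_norm _ _).trans ?_
      have h2 := T.le_opNorm (V.starProjection f)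
      have h3 : ‖V.starProjection f‖ ≤ ‖f‖ := V.norm_starProjection_apply_le f
      have h4 := mul_le_mul_of_nonneg_left h3 (norm_nonneg T)
      nlinarith [norm_nonneg f]
    have h5 := norm_sub_norm_le (inner ℂ f (S f)) (inner ℂ f (T (V.starProjection f)))
    nlinarith [hnear f, sq_nonneg ‖f‖]
  · obtain ⟨v, hv, hxv⟩ := hV x hx
    have h1 : ‖x - V.starProjection x‖ ≤ δ := by
      -- The projection fixes `v`, so the error is the orthogonal component of `x - v`.
      have h2 : x - V.starProjection x = (x - v) - V.starProjection (x - v) := by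
        rw [map_sub, Submodule.starProjection_eq_self_iff.2 hv]
        abel
      rw [h2, ← Submodule.starProjection_orthogonal_val]
      exact (Vᗮ.norm_starProjection_apply_le _).trans hxv.le
    have h2 : ‖inner ℂ x (T (V.starProjection x)) - inner ℂ x (T x)‖ ≤ ε / 2 := by
      rw [← inner_sub_right, ← map_sub]
      refine (norm_inner_le_norm _ _).trans ?_
      have h3 := T.le_opNorm (V.starProjection x - x)
      rw [norm_sub_rev] at h1
      have h4 : ‖T‖ * δ ≤ ε / 2 := by
        rw [hδ, mul_div_assoc', div_le_iff₀ (by positivity)]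
        nlinarith [norm_nonneg T]
      have h5 := mul_le_mul_of_nonneg_left h1 (norm_nonneg T)
      nlinarith [norm_nonneg (T (V.starProjection x - x)), norm_nonneg x]
    have h3 := hnear x
    have h4 : ‖x‖ ^ 2 ≤ 1 := pow_le_one₀ (norm_nonneg x) hx1
    calc _ = ‖(inner ℂ x (S x) - inner ℂ x (T (V.starProjection x)))
          + (inner ℂ x (T (V.starProjection x)) - inner ℂ x (T x))‖ := by rw [sub_add_sub_cancel]
      _ ≤ ε / 2 * ‖x‖ ^ 2 + ε / 2 := (norm_add_le _ _).trans (add_le_add h3 h2)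
      _ ≤ ε := by nlinarith

/-- The set of points near which `f` vanishes is open. It is relatively closed by the one-variable
identity theorem on complex lines inside a ball, so connectedness finishes. -/
theorem eq_zero_of_eq_zero_on_ball {U : Set (Fin n → ℂ)} (hU : IsDomainSet U)
    {f : (Fin n → ℂ) → ℂ} (hf : DifferentiableOn ℂ f U) {c : Fin n → ℂ} (hc : c ∈ U)
    (h0 : f =ᶠ[𝓝 c] 0) {z : Fin n → ℂ} (hz : z ∈ U) : f z = 0 := by
  have hsub : U ⊆ {z | f =ᶠ[𝓝 z] 0} := by
    refine hU.2.isPreconnected.subset_of_closure_inter_subset isOpen_setOfPred_eventually_nhds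
      ⟨c, hc, h0⟩ ?_
    rintro x ⟨hx, hxU⟩
    obtain ⟨r, hr, hrU⟩ := Metric.nhds_basis_ball.mem_iff.1 (hU.1.mem_nhds hxU)
    obtain ⟨y, hy, hyx⟩ := Metric.mem_closure_iff.1 hx r hr
    rw [dist_comm] at hyx
    filter_upwards [Metric.ball_mem_nhds x hr] with z hz
    set V : Set ℂ := {ζ : ℂ | y + ζ • (z - y) ∈ Metric.ball x r}
    have hline : Continuous fun ζ : ℂ => y + ζ • (z - y) := by fun_prop
    have hV : IsOpen V := Metric.isOpen_ball.preimage hline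
    have hd : DifferentiableOn ℂ (fun ζ : ℂ => f (y + ζ • (z - y))) V := by
      intro ζ hζ
      have h1 : DifferentiableAt ℂ f (y + ζ • (z - y)) :=
        hf.differentiableAt (hU.1.mem_nhds (hrU hζ))
      exact (DifferentiableAt.comp (f := fun ζ : ℂ => y + ζ • (z - y)) ζ h1
        (by fun_prop)).differentiableWithinAt
    have h0V : (0 : ℂ) ∈ V := by simpa [V] using hyx
    have h1V : (1 : ℂ) ∈ V := by simpa [V] using hz
    have hev : (fun ζ : ℂ => f (y + ζ • (z - y))) =ᶠ[𝓝 0] 0 := by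
      have ht : Tendsto (fun ζ : ℂ => y + ζ • (z - y)) (𝓝 0) (𝓝 y) := by
        simpa using hline.tendsto 0
      exact ht.eventually hy
    have h := (hd.analyticOnNhd hV).eqOn_zero_of_preconnected_of_eventuallyEq_zero
      (setOf_line_mem_ball_convex x y (z - y) r).isPreconnected h0V hev h1V
    simpa using h
  exact (hsub hz).eq_of_nhds

theorem eq_zero_of_hol_eq_zero {U : Set (Fin n → ℂ)} (hU : IsOpen U) {f : A2 U}
    (h : ∀ z ∈ U, hol f z = 0) : f = 0 := by
  have h0 : hol f = 0 := by
    ext z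
    by_cases hz : z ∈ U
    · exact h z hz
    · exact hol_of_notMem f hz
  have := norm_eq_eLpNorm_hol hU f
  rw [h0, eLpNorm_zero, ENNReal.toReal_zero] at this
  exact norm_eq_zero.1 this

/-- The Toeplitz form is the mean of `ḡ f` over the small ball and the rank one form is its value at
the centre. The local sup and Lipschitz bounds make the error linear in `s`, uniformly in `f` and
`g`. -/
theorem norm_inner_toeplitz_indicator_sub_le {U : Set (Fin n → ℂ)} (hU : IsOpen U)
    {c : Fin n → ℂ} {r s : ℝ} (hr : 0 < r) (hcr : Metric.closedBall c (3 * r) ⊆ U)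
    (hs : 0 < s) (hsr : s < r / 2)
    (hψ : MemLp ((Metric.closedBall c s).indicator fun _ =>
      ((volume.real (Metric.closedBall c s))⁻¹ : ℂ)) ∞ volume) (f g : A2 U) :
    ‖inner ℂ g (toeplitz hU hψ f) - inner ℂ g (kernelFun U c) * inner ℂ (kernelFun U c) f‖
      ≤ 2 * ballConst n r * (2 * ballConst n r / r) * s * ‖f‖ * ‖g‖ := by
  have hC : 0 ≤ ballConst n r := ballConst_nonneg n r
  generalize hCdef : ballConst n r = C at hC ⊢
  have hD : 0 ≤ 2 * C / r := by positivity
  generalize hDdef : 2 * C / r = D at hD ⊢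
  have hBr : Metric.closedBall c s ⊆ Metric.ball c (r / 2) := Metric.closedBall_subset_ball hsr
  have hB2r : Metric.ball c (r / 2) ⊆ Metric.ball c (2 * r) :=
    Metric.ball_subset_ball (by linarith)
  have hBU : Metric.closedBall c s ⊆ U := hBr.trans ((Metric.ball_subset_closedBall.trans
    (Metric.closedBall_subset_closedBall (by linarith))).trans hcr)
  have hcB : c ∈ Metric.ball c (r / 2) := Metric.mem_ball_self (by positivity)
  have hcU : c ∈ U := hBU (Metric.mem_closedBall_self hs.le)
  have hBm : MeasurableSet (Metric.closedBall c s) := measurableSet_closedBall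
  have hvol : 0 < volume.real (Metric.closedBall c s) := volumeReal_closedBall_pos hs c
  have hBfin : volume (Metric.closedBall c s) ≠ ∞ :=
    (isCompact_closedBall c s).measure_lt_top.ne
  have hcomp : IsCompact (Metric.closedBall c s) := isCompact_closedBall c s
  have hBs : ∀ w ∈ Metric.closedBall c s, dist w c ≤ s := fun _ hw => hw
  generalize Metric.closedBall c s = B at *
  have hR : inner ℂ g (kernelFun U c) = starRingEnd ℂ (hol g c) := by
    rw [← inner_kernelFun hU hcU g, inner_conj_symm]
  have hcontB : ContinuousOn (fun w => starRingEnd ℂ (hol g w) * hol f w) B :=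
    (Complex.continuous_conj.comp_continuousOn
      ((differentiableOn_hol g).continuousOn.mono hBU)).mul
      ((differentiableOn_hol f).continuousOn.mono hBU)
  have hintB := hcontB.integrableOn_compact (μ := volume) hcomp
  have hT : inner ℂ g (toeplitz hU hψ f)
      = (volume.real B : ℂ)⁻¹ * ∫ w in B, starRingEnd ℂ (hol g w) * hol f w := by
    rw [(inner_toeplitz_eq_integral hU hψ f g).2, ← integral_const_mul,
      ← integral_indicator hBm]
    refine integral_congr_ae (ae_of_all _ fun w => ?_)
    by_cases hw : w ∈ B
    · simp only [indicator_of_mem hw]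
      ring
    · simp only [indicator_of_notMem hw, mul_zero, zero_mul]
  have hdiff : inner ℂ g (toeplitz hU hψ f)
      - inner ℂ g (kernelFun U c) * inner ℂ (kernelFun U c) f
      = (volume.real B : ℂ)⁻¹ * ∫ w in B, (starRingEnd ℂ (hol g w) * hol f w
          - starRingEnd ℂ (hol g c) * hol f c) := by
    rw [hR, hT, inner_kernelFun hU hcU,
      integral_sub hintB (integrableOn_const hBfin), setIntegral_const, Complex.real_smul, mul_sub,
      inv_mul_cancel_left₀ (by exact_mod_cast hvol.ne')]
  rw [hdiff, norm_mul, norm_inv, Complex.norm_real, Real.norm_of_nonneg hvol.le,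
    ← div_eq_inv_mul, div_le_iff₀ hvol]
  refine norm_setIntegral_le_of_norm_le_const hBfin.lt_top fun w hw => ?_
  have e : starRingEnd ℂ (hol g w) * hol f w - starRingEnd ℂ (hol g c) * hol f c
      = starRingEnd ℂ (hol g w - hol g c) * hol f w
        + starRingEnd ℂ (hol g c) * (hol f w - hol f c) := by
    rw [map_sub]; ring
  have hdist : dist w c ≤ s := hBs w hw
  have g1 : ‖hol g w - hol g c‖ ≤ D * s * ‖g‖ := by
    have h := norm_hol_sub_le hU g hr hcr (hBr hw) hcB
    rw [hCdef, hDdef] at h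
    exact h.trans (by gcongr)
  have f1 : ‖hol f w - hol f c‖ ≤ D * s * ‖f‖ := by
    have h := norm_hol_sub_le hU f hr hcr (hBr hw) hcB
    rw [hCdef, hDdef] at h
    exact h.trans (by gcongr)
  have g2 : ‖hol g c‖ ≤ C * ‖g‖ := by
    have h := norm_hol_le_of_mem_ball hU g hr hcr (hB2r hcB)
    rwa [hCdef] at h
  have f2 : ‖hol f w‖ ≤ C * ‖f‖ := by
    have h := norm_hol_le_of_mem_ball hU f hr hcr (hB2r (hBr hw))
    rwa [hCdef] at h
  rw [e]
  refine (norm_add_le _ _).trans ?_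
  rw [norm_mul, norm_mul, RCLike.norm_conj, RCLike.norm_conj]
  calc ‖hol g w - hol g c‖ * ‖hol f w‖ + ‖hol g c‖ * ‖hol f w - hol f c‖
      ≤ (D * s * ‖g‖) * (C * ‖f‖) + (C * ‖g‖) * (D * s * ‖f‖) := by gcongr
    _ = 2 * C * D * s * ‖f‖ * ‖g‖ := by ring

/-- On a domain, every bounded operator is approximated by Toeplitz operators with bounded symbols
of compact support, with control of the numerical range. -/
theorem exists_compactToeplitz_approx {U : Set (Fin n → ℂ)} (hU : IsDomainSet U)
    (T : A2 U →L[ℂ] A2 U) {C : Set (A2 U)} (hC : IsCompact C) {ε : ℝ} (hε : 0 < ε) :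
    ∃ S ∈ compactToeplitz hU.1, (∀ f, ‖inner ℂ f (S f)‖ ≤ (‖T‖ + ε) * ‖f‖ ^ 2) ∧
      ∀ x ∈ C, ‖x‖ ≤ 1 → ‖inner ℂ x (S x) - inner ℂ x (T x)‖ ≤ ε := by
  have := completeSpace_A2 hU.1
  obtain ⟨c, hc⟩ := hU.2.nonempty
  obtain ⟨r, hr, hcr⟩ := Metric.nhds_basis_ball.mem_iff.1 (hU.1.mem_nhds hc)
  refine exists_approx_of_holomorphic_family ((continuousOn_kernelFun hU.1).mono hcr)
    (fun x => ((differentiableOn_hol x).mono hcr).congr fun z hz =>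
      inner_kernelFun hU.1 (hcr hz) x) (fun f hf => ?_) _ (fun z hz δ hδ => ?_) T hC hε
  -- Connectedness enters here: the kernels at the points of one ball already span a dense subspace.
  · refine eq_zero_of_hol_eq_zero hU.1 fun z hz =>
      eq_zero_of_eq_zero_on_ball hU (differentiableOn_hol f) hc ?_ hz
    filter_upwards [Metric.ball_mem_nhds c hr] with w hw
    rw [← inner_kernelFun hU.1 (hcr hw)]
    exact hf w hw
  · obtain ⟨r, hr, hcr⟩ := exists_closedBall_three_subset hU.1 (hcr hz)
    have hlim : Tendsto (fun s : ℝ => 2 * ballConst n r * (2 * ballConst n r / r) * s)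
        (𝓝[>] 0) (𝓝 0) :=
      tendsto_nhdsWithin_of_tendsto_nhds (by
        simpa using (continuous_const_mul
          (2 * ballConst n r * (2 * ballConst n r / r))).tendsto (0 : ℝ))
    obtain ⟨s, hsε, hs⟩ := ((hlim.eventually (gt_mem_nhds hδ)).and
      (Ioo_mem_nhdsGT (half_pos hr))).exists
    have hψ : MemLp ((Metric.closedBall z s).indicator fun _ =>
        ((volume.real (Metric.closedBall z s))⁻¹ : ℂ)) ∞ volume :=
      (memLp_top_const _).indicator measurableSet_closedBall
    refine ⟨toeplitz hU.1 hψ, ⟨_, hψ, Metric.closedBall z s, isCompact_closedBall _ _,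
      (Metric.closedBall_subset_closedBall (by linarith [hs.2])).trans hcr,
      fun z hz => indicator_of_notMem hz _, rfl⟩, fun f g => ?_⟩
    refine (norm_inner_toeplitz_indicator_sub_le hU.1 hr hcr hs.1 hs.2 hψ f g).trans ?_
    gcongr

/-! ### Comparison of Bergman spaces of nested domains -/

theorem exists_restrict {U V : Set (Fin n → ℂ)} (hU : IsOpen U) (hV : IsOpen V) (hUV : U ⊆ V)
    (f : A2 V) : ∃ f' : A2 U, EqOn (hol f') (hol f) U := by
  have hm : MemLp (hol f) 2 (volume.restrict U) := (memLp_hol hV f).restrict U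
  have hd : DifferentiableOn ℂ (hol f) U := (differentiableOn_hol f).mono hUV
  exact ⟨⟨hm.toLp (hol f), hol f, hd, hm.coeFn_toLp⟩, hol_eqOn hU _ hd hm.coeFn_toLp⟩

/-- The zero extension of `K_z^U` sees only the restriction of `f` to `U`, which lies in `A²(U)`. -/
theorem inner_extendL_kernelFun {U V : Set (Fin n → ℂ)} (hU : IsOpen U) (hV : IsOpen V)
    (hUV : U ⊆ V) {z : Fin n → ℂ} (hz : z ∈ U) (f : A2 V) :
    inner ℂ (extendL hU (kernelFun U z)) (extendL hV f) = hol f z := by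
  obtain ⟨f', hf'⟩ := exists_restrict hU hV hUV f
  rw [← hf' hz, ← inner_kernelFun hU hz f', ← inner_extendL hU, L2.inner_def, L2.inner_def]
  refine integral_congr_ae ?_
  filter_upwards [coeFn_extendL hU (kernelFun U z), coeFn_extendL hV f, coeFn_extendL hU f']
    with w h1 h2 h3
  rw [h1, h2, h3]
  by_cases hw : w ∈ U
  · rw [hf' hw]
  · rw [hol_of_notMem _ hw, inner_zero_left, inner_zero_left]

/-- Expand the square; by reproduction on `U`, the cross term is `K^V(z, z)`. -/
theorem norm_extendL_kernelFun_sub_sq {U V : Set (Fin n → ℂ)} (hU : IsOpen U) (hV : IsOpen V)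
    (hUV : U ⊆ V) {z : Fin n → ℂ} (hz : z ∈ U) :
    ‖extendL hU (kernelFun U z) - extendL hV (kernelFun V z)‖ ^ 2
      = ‖kernelFun U z‖ ^ 2 - ‖kernelFun V z‖ ^ 2 := by
  have h := bergmanKernel_self hV (hUV hz)
  rw [bergmanKernel] at h
  rw [norm_sub_sq (𝕜 := ℂ), inner_extendL_kernelFun hU hV hUV hz, h, LinearIsometry.norm_map,
    LinearIsometry.norm_map]
  simp only [RCLike.re_to_complex, Complex.ofReal_re]
  ring

theorem norm_kernelFun_anti {U V : Set (Fin n → ℂ)} (hU : IsOpen U) (hV : IsOpen V)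
    (hUV : U ⊆ V) {z : Fin n → ℂ} (hz : z ∈ U) :
    ‖kernelFun V z‖ ^ 2 ≤ ‖kernelFun U z‖ ^ 2 := by
  have h := norm_extendL_kernelFun_sub_sq hU hV hUV hz
  nlinarith [sq_nonneg ‖extendL hU (kernelFun U z) - extendL hV (kernelFun V z)‖]

theorem restrict_extendL_mem {U V : Set (Fin n → ℂ)} (hV : IsOpen V)
    (hUV : U ⊆ V) (f : A2 V) :
    LpToLpRestrictCLM (Fin n → ℂ) ℂ ℂ volume 2 U (extendL hV f) ∈ A2 U :=
  ⟨hol f, (differentiableOn_hol f).mono hUV,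
    (LpToLpRestrictCLM_coeFn ℂ U _).trans (ae_restrict_of_ae (coeFn_extendL hV f))⟩

/-- A limit in `L²(ℂⁿ)` of elements of `A²(Ω_j)` belongs to `A²(⋃ Ω_j)`. -/
theorem exists_extendL_eq_of_tendsto {Ωs : ℕ → Set (Fin n → ℂ)} (hopen : ∀ j, IsOpen (Ωs j))
    (hmono : Monotone Ωs) (hΩ : IsOpen (⋃ j, Ωs j)) {j : ℕ → ℕ} (hj : Tendsto j atTop atTop)
    (F : ∀ i, A2 (Ωs (j i))) {x : Lp ℂ 2 (volume : Measure (Fin n → ℂ))}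
    (hx : Tendsto (fun i => extendL (hopen (j i)) (F i)) atTop (𝓝 x)) :
    ∃ f : A2 (⋃ j, Ωs j), extendL hΩ f = x := by
  have hres : ∀ i, LpToLpRestrictCLM (Fin n → ℂ) ℂ ℂ volume 2 (Ωs i) x ∈ A2 (Ωs i) := by
    intro i
    refine (isClosed_A2 (hopen i)).mem_of_tendsto
      (((LpToLpRestrictCLM (Fin n → ℂ) ℂ ℂ volume 2 (Ωs i)).continuous.tendsto x).comp hx) ?_
    filter_upwards [hj.eventually_ge_atTop i] with m hm
    exact restrict_extendL_mem (hopen _) (hmono hm) _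
  have hg : ∀ i, ∃ g : (Fin n → ℂ) → ℂ, DifferentiableOn ℂ g (Ωs i) ∧
      x =ᵐ[volume.restrict (Ωs i)] g := by
    intro i
    obtain ⟨g, hg, hgx⟩ := hres i
    exact ⟨g, hg, (LpToLpRestrictCLM_coeFn ℂ (Ωs i) x).symm.trans hgx⟩
  choose g hgd hgx using hg
  have hagree : ∀ i k, i ≤ k → EqOn (g i) (g k) (Ωs i) := fun i k hik =>
    Measure.eqOn_open_of_ae_eq ((hgx i).symm.trans
      (ae_restrict_of_ae_restrict_of_subset (hmono hik) (hgx k))) (hopen i)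
      (hgd i).continuousOn ((hgd k).continuousOn.mono (hmono hik))
  have hidx : ∀ z, ∃ i, z ∈ (⋃ j, Ωs j) → z ∈ Ωs i := by
    intro z
    by_cases hz : z ∈ ⋃ j, Ωs j
    · obtain ⟨i, hi⟩ := mem_iUnion.1 hz
      exact ⟨i, fun _ => hi⟩
    · exact ⟨0, fun h => absurd h hz⟩
  choose idx hidx using hidx
  -- The local representatives agree on overlaps, so the glued function does not depend on the
  -- chosen index.
  have hG : ∀ i, EqOn (fun z => g (idx z) z) (g i) (Ωs i) := by
    intro i z hz
    have hz' := hidx z (mem_iUnion_of_mem i hz)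
    rcases le_total (idx z) i with h | h
    · exact hagree _ _ h hz'
    · exact (hagree _ _ h hz).symm
  have hGd : DifferentiableOn ℂ (fun z => g (idx z) z) (⋃ j, Ωs j) := by
    intro z hz
    obtain ⟨i, hi⟩ := mem_iUnion.1 hz
    have h1 : DifferentiableAt ℂ (g i) z := (hgd i).differentiableAt ((hopen i).mem_nhds hi)
    refine (h1.congr_of_eventuallyEq ?_).differentiableWithinAt
    filter_upwards [(hopen i).mem_nhds hi] with w hw using hG i hw
  have hGx : x =ᵐ[volume.restrict (⋃ j, Ωs j)] fun z => g (idx z) z := by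
    refine (ae_restrict_iUnion_iff _ _).2 fun i => ?_
    filter_upwards [hgx i, ae_restrict_mem (hopen i).measurableSet] with z h1 h2
    rw [h1, ← hG i h2]
  have hf : LpToLpRestrictCLM (Fin n → ℂ) ℂ ℂ volume 2 (⋃ j, Ωs j) x ∈ A2 (⋃ j, Ωs j) :=
    ⟨_, hGd, (LpToLpRestrictCLM_coeFn ℂ _ x).trans hGx⟩
  -- Every approximant vanishes off the union, and restriction to the complement is continuous.
  have hzero : LpToLpRestrictCLM (Fin n → ℂ) ℂ ℂ volume 2 (⋃ j, Ωs j)ᶜ x = 0 := by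
    refine tendsto_nhds_unique
      (((LpToLpRestrictCLM (Fin n → ℂ) ℂ ℂ volume 2 (⋃ j, Ωs j)ᶜ).continuous.tendsto x).comp hx)
      (tendsto_const_nhds.congr fun i => ?_)
    refine Lp.ext ?_
    filter_upwards [LpToLpRestrictCLM_coeFn ℂ (⋃ j, Ωs j)ᶜ (extendL (hopen (j i)) (F i)),
      Lp.coeFn_zero ℂ 2 (volume.restrict (⋃ j, Ωs j)ᶜ),
      ae_restrict_of_ae (coeFn_extendL (hopen (j i)) (F i)),
      ae_restrict_mem hΩ.measurableSet.compl] with z h1 h2 h3 h4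
    rw [h2, Function.comp_apply, h1, h3, hol_of_notMem _ fun h => h4 (mem_iUnion_of_mem _ h)]
    rfl
  refine ⟨⟨_, hf⟩, Lp.ext ?_⟩
  refine ae_of_ae_restrict_of_ae_restrict_compl (⋃ j, Ωs j) ?_ ?_
  · filter_upwards [ae_restrict_of_ae (coeFn_extendL hΩ ⟨_, hf⟩), coeFn_ae_eq_hol hΩ ⟨_, hf⟩,
      LpToLpRestrictCLM_coeFn ℂ (⋃ j, Ωs j) x] with z h1 h2 h3
    rw [h1, ← h2, ← h3]
  · have h0 := LpToLpRestrictCLM_coeFn (p := 2) ℂ (⋃ j, Ωs j)ᶜ x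
    rw [hzero] at h0
    filter_upwards [ae_restrict_of_ae (coeFn_extendL hΩ ⟨_, hf⟩), h0,
      Lp.coeFn_zero ℂ 2 (volume.restrict (⋃ j, Ωs j)ᶜ),
      ae_restrict_mem hΩ.measurableSet.compl] with z h1 h2 h3 h4
    rw [h1, ← h2, h3, hol_of_notMem _ h4]
    rfl

/-- Ramadanov's theorem on the diagonal. -/
theorem tendsto_norm_kernelFun {Ωs : ℕ → Set (Fin n → ℂ)} (hopen : ∀ j, IsOpen (Ωs j))
    (hmono : Monotone Ωs) (hΩ : IsOpen (⋃ j, Ωs j)) {z : Fin n → ℂ} {m : ℕ} (hz : z ∈ Ωs m) :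
    Tendsto (fun i => ‖kernelFun (Ωs (i + m)) z‖ ^ 2) atTop
      (𝓝 (‖kernelFun (⋃ j, Ωs j) z‖ ^ 2)) := by
  have hzm : ∀ i, z ∈ Ωs (i + m) := fun i => hmono (Nat.le_add_left m i) hz
  have hanti : Antitone fun i => ‖kernelFun (Ωs (i + m)) z‖ ^ 2 := fun i k hik =>
    norm_kernelFun_anti (hopen _) (hopen _) (hmono (Nat.add_le_add_right hik m)) (hzm i)
  obtain ⟨a, ha⟩ : ∃ a, Tendsto (fun i => ‖kernelFun (Ωs (i + m)) z‖ ^ 2) atTop (𝓝 a) :=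
    ⟨_, tendsto_atTop_ciInf hanti ⟨0, by rintro _ ⟨i, rfl⟩; positivity⟩⟩
  -- The diagonal values decrease and converge, and their differences are the squared distances
  -- between the kernels.
  have hcauchy : CauchySeq fun i => extendL (hopen (i + m)) (kernelFun (Ωs (i + m)) z) := by
    refine Metric.cauchySeq_iff'.2 fun ε hε => ?_
    obtain ⟨N, hN⟩ := Metric.cauchySeq_iff'.1 ha.cauchySeq (ε ^ 2) (by positivity)
    refine ⟨N, fun i hi => ?_⟩
    have h1 := norm_extendL_kernelFun_sub_sq (hopen (N + m)) (hopen (i + m))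
      (hmono (Nat.add_le_add_right hi m)) (hzm N)
    have h2 := hN i hi
    rw [Real.dist_eq, abs_lt] at h2
    rw [dist_comm, dist_eq_norm]
    exact lt_of_pow_lt_pow_left₀ 2 hε.le (by rw [h1]; linarith)
  obtain ⟨x, hx⟩ := cauchySeq_tendsto_of_complete hcauchy
  obtain ⟨f, hf⟩ := exists_extendL_eq_of_tendsto hopen hmono hΩ
    (tendsto_add_atTop_nat m) (fun i => kernelFun (Ωs (i + m)) z) hx
  have hrep : IsReproducing (⋃ j, Ωs j) z f := by
    intro h
    have h1 : Tendsto (fun i => inner ℂ (extendL (hopen (i + m)) (kernelFun (Ωs (i + m)) z))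
        (extendL hΩ h)) atTop (𝓝 (inner ℂ x (extendL hΩ h))) := hx.inner tendsto_const_nhds
    simp only [inner_extendL_kernelFun (hopen _) hΩ (subset_iUnion Ωs _) (hzm _)] at h1
    have h2 := tendsto_nhds_unique h1 tendsto_const_nhds
    rw [← hf, inner_extendL] at h2
    exact h2
  have hfK : f = kernelFun (⋃ j, Ωs j) z := hrep.unique fun h =>
    inner_kernelFun hΩ (mem_iUnion_of_mem m hz) h
  have hnorm := hx.norm.pow 2
  simp only [LinearIsometry.norm_map] at hnorm
  rwa [← hf, LinearIsometry.norm_map, hfK] at hnorm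

theorem eventually_subset_of_isCompact {Ωs : ℕ → Set (Fin n → ℂ)} (hopen : ∀ j, IsOpen (Ωs j))
    (hmono : Monotone Ωs) {L : Set (Fin n → ℂ)} (hL : IsCompact L) (hLΩ : L ⊆ ⋃ j, Ωs j) :
    ∀ᶠ j in atTop, L ⊆ Ωs j := by
  obtain ⟨m, hm⟩ := hL.elim_directed_cover Ωs hopen hLΩ hmono.directed_le
  filter_upwards [eventually_ge_atTop m] with j hj
  exact hm.trans (hmono hj)

/-- Dini's theorem: the diagonal values are continuous and decrease to a continuous limit. -/
theorem eventually_norm_kernelFun_sub_lt {Ωs : ℕ → Set (Fin n → ℂ)}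
    (hopen : ∀ j, IsOpen (Ωs j)) (hmono : Monotone Ωs) (hΩ : IsOpen (⋃ j, Ωs j))
    {L : Set (Fin n → ℂ)} (hL : IsCompact L) (hLΩ : L ⊆ ⋃ j, Ωs j) {ε : ℝ} (hε : 0 < ε) :
    ∀ᶠ j in atTop, ∀ z ∈ L,
      ‖kernelFun (Ωs j) z‖ ^ 2 - ‖kernelFun (⋃ j, Ωs j) z‖ ^ 2 < ε := by
  obtain ⟨m, hm⟩ := (eventually_subset_of_isCompact hopen hmono hL hLΩ).exists
  have hLi : ∀ i, L ⊆ Ωs (i + m) := fun i => hm.trans (hmono (Nat.le_add_left m i))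
  have hdini := Antitone.tendstoUniformlyOn_of_forall_tendsto hL
    (F := fun i z => ‖kernelFun (Ωs (i + m)) z‖ ^ 2)
    (f := fun z => ‖kernelFun (⋃ j, Ωs j) z‖ ^ 2)
    (fun i => (((continuousOn_kernelFun (hopen _)).mono (hLi i)).norm.pow 2))
    (fun z hz i k hik => norm_kernelFun_anti (hopen _) (hopen _)
      (hmono (Nat.add_le_add_right hik m)) (hLi i hz))
    (((continuousOn_kernelFun hΩ).mono hLΩ).norm.pow 2)
    (fun z hz => tendsto_norm_kernelFun hopen hmono hΩ (hm hz))
  have h := Metric.tendstoUniformlyOn_iff.1 hdini ε hε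
  obtain ⟨N, hN⟩ := eventually_atTop.1 h
  filter_upwards [eventually_ge_atTop (N + m)] with j hj z hz
  have h1 := hN (j - m) (Nat.le_sub_of_add_le hj) z hz
  rw [Nat.sub_add_cancel (le_of_add_le_right hj), dist_comm, Real.dist_eq] at h1
  exact (le_abs_self _).trans_lt h1

/-! ### Berezin transforms on nested domains -/

theorem norm_inner_map_self_sub_le {H : Type*} [NormedAddCommGroup H] [InnerProductSpace ℂ H]
    (M : H →L[ℂ] H) {u v : H} (hu : ‖u‖ ≤ 1) (hv : ‖v‖ ≤ 1) :
    ‖inner ℂ u (M u) - inner ℂ v (M v)‖ ≤ 2 * ‖M‖ * ‖u - v‖ := by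
  have e : inner ℂ u (M u) - inner ℂ v (M v) = inner ℂ (u - v) (M u) + inner ℂ v (M (u - v)) := by
    rw [inner_sub_left, map_sub, inner_sub_right]; ring
  rw [e]
  have h1 : ‖inner ℂ (u - v) (M u)‖ ≤ ‖u - v‖ * (‖M‖ * 1) :=
    (norm_inner_le_norm _ _).trans (by gcongr; exact M.le_opNorm_of_le hu)
  have h2 : ‖inner ℂ v (M (u - v))‖ ≤ 1 * (‖M‖ * ‖u - v‖) :=
    (norm_inner_le_norm _ _).trans (by gcongr; exact M.le_opNorm _)
  refine (norm_add_le _ _).trans ?_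
  linarith

/-- Multiplied by `‖v‖`, the difference is `(‖v‖ - ‖u‖)` times a vector of norm at most `1`, plus `u
- v`. The case `u = 0` is covered by `0⁻¹ = 0`. -/
theorem norm_normalize_sub_le {H : Type*} [NormedAddCommGroup H] [NormedSpace ℂ H]
    (u : H) {v : H} (hv : v ≠ 0) :
    ‖(‖u‖ : ℂ)⁻¹ • u - (‖v‖ : ℂ)⁻¹ • v‖ ≤ 2 * ‖u - v‖ / ‖v‖ := by
  have hv0 : 0 < ‖v‖ := norm_pos_iff.2 hv
  have hvc : (‖v‖ : ℂ) ≠ 0 := by exact_mod_cast hv0.ne'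
  have hu : (‖u‖ : ℂ) • ((‖u‖ : ℂ)⁻¹ • u) = u := by
    rcases eq_or_ne u 0 with rfl | h
    · simp
    · exact smul_inv_smul₀ (by simpa using h) _
  have hu1 : ‖(‖u‖ : ℂ)⁻¹ • u‖ ≤ 1 := by
    rw [norm_smul, norm_inv, Complex.norm_real, norm_norm]
    exact inv_mul_le_one
  have e : (‖v‖ : ℂ) • ((‖u‖ : ℂ)⁻¹ • u - (‖v‖ : ℂ)⁻¹ • v)
      = ((‖v‖ : ℂ) - (‖u‖ : ℂ)) • ((‖u‖ : ℂ)⁻¹ • u) + (u - v) := by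
    rw [smul_sub, smul_inv_smul₀ hvc, sub_smul, hu]
    abel
  have h := congrArg norm e
  rw [norm_smul, Complex.norm_real, norm_norm] at h
  have h1 : ‖((‖v‖ : ℂ) - (‖u‖ : ℂ)) • ((‖u‖ : ℂ)⁻¹ • u)‖ ≤ ‖u - v‖ := by
    rw [norm_smul, ← Complex.ofReal_sub, Complex.norm_real]
    have h2 : ‖‖v‖ - ‖u‖‖ ≤ ‖u - v‖ := by
      rw [norm_sub_rev u v]
      exact abs_norm_sub_norm_le v u
    exact (mul_le_of_le_one_right (norm_nonneg _) hu1).trans h2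
  rw [le_div_iff₀ hv0, mul_comm, h]
  refine (norm_add_le _ _).trans ?_
  linarith

theorem extendL_normalizedKernel {U : Set (Fin n → ℂ)} (hU : IsOpen U) {z : Fin n → ℂ}
    (hz : z ∈ U) : extendL hU (normalizedKernel U z)
      = (‖extendL hU (kernelFun U z)‖ : ℂ)⁻¹ • extendL hU (kernelFun U z) := by
  rw [normalizedKernel_eq hU hz, map_smul, LinearIsometry.norm_map]

/-- Both sides evaluate the same multiplication form on `L²(ℂⁿ)`, at normalized kernels whose
distance is read off from the diagonals. -/
theorem norm_berezin_toeplitz_sub_le {U V : Set (Fin n → ℂ)} (hU : IsOpen U) (hV : IsOpen V)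
    (hUV : U ⊆ V) {z : Fin n → ℂ} (hz : z ∈ U) (hz0 : kernelFun V z ≠ 0)
    {ψ : (Fin n → ℂ) → ℂ} (hψ : MemLp ψ ∞ volume) :
    ‖berezin (toeplitz hU hψ) z - berezin (toeplitz hV hψ) z‖
      ≤ 4 * ‖mulL hψ‖ * (√(‖kernelFun U z‖ ^ 2 - ‖kernelFun V z‖ ^ 2) / ‖kernelFun V z‖) := by
  rw [berezin_toeplitz, berezin_toeplitz]
  have h1 : ‖extendL hU (normalizedKernel U z)‖ ≤ 1 := by
    rw [LinearIsometry.norm_map]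
    exact norm_normalizedKernel_le hU hz
  have h2 : ‖extendL hV (normalizedKernel V z)‖ ≤ 1 := by
    rw [LinearIsometry.norm_map]
    exact norm_normalizedKernel_le hV (hUV hz)
  have h3 : extendL hV (kernelFun V z) ≠ 0 := by
    rw [← norm_ne_zero_iff, LinearIsometry.norm_map]
    exact norm_ne_zero_iff.2 hz0
  have h4 := norm_normalize_sub_le (extendL hU (kernelFun U z)) h3
  rw [← extendL_normalizedKernel hU hz, ← extendL_normalizedKernel hV (hUV hz),
    LinearIsometry.norm_map (extendL hV)] at h4
  rw [← norm_extendL_kernelFun_sub_sq hU hV hUV hz, Real.sqrt_sq (norm_nonneg _)]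
  calc _ ≤ 2 * ‖mulL hψ‖
        * ‖extendL hU (normalizedKernel U z) - extendL hV (normalizedKernel V z)‖ :=
        norm_inner_map_self_sub_le _ h1 h2
    _ ≤ 2 * ‖mulL hψ‖ * (2 * ‖extendL hU (kernelFun U z) - extendL hV (kernelFun V z)‖
        / ‖kernelFun V z‖) := by gcongr
    _ = _ := by ring

/-- The two values are pairings of the extended `f` with the extended kernels of `U` and `V`; only
the kernel difference remains. -/
theorem norm_hol_sub_hol_projL_le {U V : Set (Fin n → ℂ)} (hU : IsOpen U) (hV : IsOpen V)
    (hUV : U ⊆ V) {z : Fin n → ℂ} (hz : z ∈ U) (f : A2 U) :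
    ‖hol f z - hol (projL hV (extendL hU f)) z‖
      ≤ √(‖kernelFun U z‖ ^ 2 - ‖kernelFun V z‖ ^ 2) * ‖f‖ := by
  rw [← inner_kernelFun hU hz, ← inner_kernelFun hV (hUV hz), inner_projL, ← inner_extendL hU,
    ← inner_sub_left, ← norm_extendL_kernelFun_sub_sq hU hV hUV hz, Real.sqrt_sq (norm_nonneg _),
    ← (extendL hU).norm_map f]
  exact norm_inner_le_norm _ _

/-- Since `ψ` lives on `L`, the difference `x - y` may be cut off to `L`, where the sup bound
controls its `L²` norm. -/
theorem norm_inner_mulL_sub_le {ψ : (Fin n → ℂ) → ℂ} (hψ : MemLp ψ ∞ volume)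
    {L : Set (Fin n → ℂ)} (hL : MeasurableSet L) (hLfin : volume L ≠ ∞)
    (hψL : ∀ z ∉ L, ψ z = 0) {x y : Lp ℂ 2 (volume : Measure (Fin n → ℂ))}
    {f g : (Fin n → ℂ) → ℂ} (hx : x =ᵐ[volume] f) (hy : y =ᵐ[volume] g) {δ : ℝ} (hδ : 0 ≤ δ)
    (hfg : ∀ z ∈ L, ‖f z - g z‖ ≤ δ) :
    ‖inner ℂ x (mulL hψ x) - inner ℂ y (mulL hψ y)‖
      ≤ ‖mulL hψ‖ * (δ * volume.real L ^ (1 / (2 : ℝ≥0∞).toReal)) * (‖x‖ + ‖y‖) := by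
  have hmem : MemLp (L.indicator (f - g)) 2 volume :=
    ((memLp_congr_ae hx).1 (Lp.memLp x) |>.sub ((memLp_congr_ae hy).1 (Lp.memLp y))).indicator hL
  set d := hmem.toLp _ with hd
  have hdae : d =ᵐ[volume] L.indicator (f - g) := hmem.coeFn_toLp
  have e1 : mulL hψ (x - y) = mulL hψ d := by
    refine Lp.ext ?_
    filter_upwards [coeFn_mulL hψ (x - y), coeFn_mulL hψ d, hdae, Lp.coeFn_sub x y, hx, hy]
      with z h1 h2 h3 h4 h5 h6
    rw [h1, h2, h3, h4]
    by_cases hz : z ∈ L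
    · rw [indicator_of_mem hz, Pi.sub_apply, Pi.sub_apply, h5, h6]
    · rw [hψL z hz, zero_mul, zero_mul]
  have e2 : inner ℂ (x - y) (mulL hψ x) = inner ℂ d (mulL hψ x) := by
    rw [L2.inner_def, L2.inner_def]
    refine integral_congr_ae ?_
    filter_upwards [coeFn_mulL hψ x, hdae, Lp.coeFn_sub x y, hx, hy] with z h1 h3 h4 h5 h6
    rw [h1, h3, h4]
    by_cases hz : z ∈ L
    · rw [indicator_of_mem hz, Pi.sub_apply, Pi.sub_apply, h5, h6]
    · rw [hψL z hz, zero_mul, inner_zero_right, inner_zero_right]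
  have hdn : ‖d‖ ≤ δ * volume.real L ^ (1 / (2 : ℝ≥0∞).toReal) := by
    have h := norm_indicatorConstLp (μ := (volume : Measure (Fin n → ℂ))) (p := 2) (hs := hL)
      (hμs := hLfin) (c := (δ : ℂ)) two_ne_zero ENNReal.ofNat_ne_top
    rw [Complex.norm_real, Real.norm_of_nonneg hδ] at h
    rw [← h]
    refine Lp.norm_le_norm_of_ae_le ?_
    filter_upwards [hdae, indicatorConstLp_coeFn (p := 2) (hs := hL) (hμs := hLfin)
      (c := (δ : ℂ))] with z h1 h2
    rw [h1, h2]
    by_cases hz : z ∈ L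
    · rw [indicator_of_mem hz, indicator_of_mem hz, Complex.norm_real, Real.norm_of_nonneg hδ]
      exact hfg z hz
    · rw [indicator_of_notMem hz, indicator_of_notMem hz]
  have e : inner ℂ x (mulL hψ x) - inner ℂ y (mulL hψ y)
      = inner ℂ d (mulL hψ x) + inner ℂ y (mulL hψ d) := by
    rw [← e2, ← e1, inner_sub_left, map_sub, inner_sub_right]
    ring
  have h1 : ‖inner ℂ d (mulL hψ x)‖ ≤ ‖d‖ * (‖mulL hψ‖ * ‖x‖) :=
    (norm_inner_le_norm _ _).trans (by gcongr; exact (mulL hψ).le_opNorm _)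
  have h2 : ‖inner ℂ y (mulL hψ d)‖ ≤ ‖y‖ * (‖mulL hψ‖ * ‖d‖) :=
    (norm_inner_le_norm _ _).trans (by gcongr; exact (mulL hψ).le_opNorm _)
  rw [e]
  calc _ ≤ ‖mulL hψ‖ * ‖d‖ * (‖x‖ + ‖y‖) := (norm_add_le _ _).trans (by linarith)
    _ ≤ _ := by gcongr

theorem norm_berezin_le {U : Set (Fin n → ℂ)} (hU : IsOpen U) (T : A2 U →L[ℂ] A2 U)
    {z : Fin n → ℂ} (hz : z ∈ U) : ‖berezin T z‖ ≤ ‖T‖ := by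
  have h := norm_normalizedKernel_le hU hz
  refine (norm_inner_le_norm (𝕜 := ℂ) (normalizedKernel U z) (T (normalizedKernel U z))).trans ?_
  have h2 := T.le_opNorm_of_le h
  nlinarith [norm_nonneg (T (normalizedKernel U z)), norm_nonneg (normalizedKernel U z)]

/-- The Berezin transforms of the Toeplitz operators with a fixed bounded symbol of compact support
converge uniformly on compact subsets of `Ω ∖ 𝒵`. -/
theorem eventually_norm_berezin_toeplitz_sub_le {Ωs : ℕ → Set (Fin n → ℂ)}
    (hopen : ∀ j, IsOpen (Ωs j)) (hmono : Monotone Ωs) (hΩ : IsOpen (⋃ j, Ωs j))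
    {K : Set (Fin n → ℂ)} (hK : IsCompact K)
    (hKΩ : K ⊆ (⋃ j, Ωs j) \ zeroSet (⋃ j, Ωs j))
    {ψ : (Fin n → ℂ) → ℂ} (hψ : MemLp ψ ∞ volume) {ε : ℝ} (hε : 0 < ε) :
    ∀ᶠ j in atTop, ∀ z ∈ K,
      ‖berezin (toeplitz (hopen j) hψ) z - berezin (toeplitz hΩ hψ) z‖ ≤ ε := by
  have hKU : K ⊆ ⋃ j, Ωs j := hKΩ.trans sdiff_subset
  -- Normalization divides by the kernel norm, which has a positive minimum on `K` away from `𝒵`.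
  obtain ⟨c, hc, hcK⟩ : ∃ c > 0, ∀ z ∈ K, c ≤ ‖kernelFun (⋃ j, Ωs j) z‖ := by
    rcases K.eq_empty_or_nonempty with rfl | hne
    · exact ⟨1, one_pos, fun z hz => absurd hz (notMem_empty z)⟩
    · obtain ⟨w, hw, hmin⟩ := hK.exists_isMinOn hne ((continuousOn_kernelFun hΩ).mono hKU).norm
      exact ⟨_, norm_pos_iff.2 ((mem_diff_zeroSet_iff hΩ).1 (hKΩ hw)).2, fun z hz => hmin hz⟩
  set η : ℝ := ε * c / (4 * ‖mulL hψ‖ + 1) with hη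
  have hη0 : 0 < η := by positivity
  filter_upwards [eventually_subset_of_isCompact hopen hmono hK hKU,
    eventually_norm_kernelFun_sub_lt hopen hmono hΩ hK hKU (pow_pos hη0 2)] with j hj1 hj2 z hz
  refine (norm_berezin_toeplitz_sub_le (hopen j) hΩ (subset_iUnion Ωs j) (hj1 hz)
    ((mem_diff_zeroSet_iff hΩ).1 (hKΩ hz)).2 hψ).trans ?_
  have h1 : √(‖kernelFun (Ωs j) z‖ ^ 2 - ‖kernelFun (⋃ j, Ωs j) z‖ ^ 2) ≤ η := by
    rw [← Real.sqrt_sq hη0.le]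
    exact Real.sqrt_le_sqrt (hj2 z hz).le
  have h2 : 4 * ‖mulL hψ‖ * η ≤ ε * c := by
    rw [hη, mul_div_assoc', div_le_iff₀ (by positivity)]
    nlinarith [norm_nonneg (mulL hψ), mul_pos hε hc]
  calc _ ≤ 4 * ‖mulL hψ‖ * (η / c) := by gcongr; exact hcK z hz
    _ ≤ ε := by rw [← mul_div_assoc, div_le_iff₀ hc]; exact h2

/-- Project the normalized kernel of `Ω_j` to `A²(Ω)`. On the compact support of `ψ` it changes
little, uniformly in `z`, so the numerical range bound on `Ω` carries over to all of `Ω_j`. -/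
theorem eventually_norm_berezin_toeplitz_le {Ωs : ℕ → Set (Fin n → ℂ)}
    (hopen : ∀ j, IsOpen (Ωs j)) (hmono : Monotone Ωs) (hΩ : IsOpen (⋃ j, Ωs j))
    {L : Set (Fin n → ℂ)} (hL : IsCompact L) (hLΩ : L ⊆ ⋃ j, Ωs j)
    {ψ : (Fin n → ℂ) → ℂ} (hψ : MemLp ψ ∞ volume) (hψL : ∀ z ∉ L, ψ z = 0)
    {M : ℝ} (hM : 0 ≤ M) (hbound : ∀ f, ‖inner ℂ f (toeplitz hΩ hψ f)‖ ≤ M * ‖f‖ ^ 2)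
    {ε : ℝ} (hε : 0 < ε) :
    ∀ᶠ j in atTop, ∀ z ∈ Ωs j, ‖berezin (toeplitz (hopen j) hψ) z‖ ≤ M + ε := by
  set v : ℝ := volume.real L ^ (1 / (2 : ℝ≥0∞).toReal) with hv
  have hv0 : 0 ≤ v := by positivity
  -- Makes the error `2 * ‖mulL hψ‖ * δ * v` at most `ε`; the `+ 1` avoids division by zero.
  set δ : ℝ := ε / (2 * (‖mulL hψ‖ * v) + 1) with hδ
  have hδ0 : 0 < δ := by positivity
  filter_upwards [eventually_subset_of_isCompact hopen hmono hL hLΩ,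
    eventually_norm_kernelFun_sub_lt hopen hmono hΩ hL hLΩ (pow_pos hδ0 2)] with j hj1 hj2 z hz
  set f := normalizedKernel (Ωs j) z
  have hf : ‖f‖ ≤ 1 := norm_normalizedKernel_le (hopen j) hz
  set g := projL hΩ (extendL (hopen j) f)
  have hx : ‖extendL (hopen j) f‖ ≤ 1 := by rwa [LinearIsometry.norm_map]
  have hg : ‖g‖ ≤ 1 := (norm_projL_le hΩ _).trans hx
  have hy : ‖extendL hΩ g‖ ≤ 1 := by rwa [LinearIsometry.norm_map]
  have hfg : ∀ w ∈ L, ‖hol f w - hol g w‖ ≤ δ := by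
    intro w hw
    refine (norm_hol_sub_hol_projL_le (hopen j) hΩ (subset_iUnion Ωs j) (hj1 hw) f).trans ?_
    have h1 : √(‖kernelFun (Ωs j) w‖ ^ 2 - ‖kernelFun (⋃ j, Ωs j) w‖ ^ 2) ≤ δ := by
      rw [← Real.sqrt_sq hδ0.le]
      exact Real.sqrt_le_sqrt (hj2 w hw).le
    exact (mul_le_of_le_one_right (Real.sqrt_nonneg _) hf).trans h1
  have h1 := norm_inner_mulL_sub_le hψ hL.measurableSet hL.measure_lt_top.ne hψL
    (coeFn_extendL (hopen j) f) (coeFn_extendL hΩ g) hδ0.le hfg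
  have h2 := hbound g
  rw [inner_toeplitz] at h2
  rw [berezin_toeplitz]
  have h3 : ‖mulL hψ‖ * (δ * v) * (‖extendL (hopen j) f‖ + ‖extendL hΩ g‖) ≤ ε := by
    have h4 : ‖mulL hψ‖ * (δ * v) * (‖extendL (hopen j) f‖ + ‖extendL hΩ g‖)
        ≤ ‖mulL hψ‖ * (δ * v) * (1 + 1) := by gcongr
    refine h4.trans ?_
    rw [hδ, show ‖mulL hψ‖ * (ε / (2 * (‖mulL hψ‖ * v) + 1) * v) * (1 + 1)
      = ε * (2 * (‖mulL hψ‖ * v)) / (2 * (‖mulL hψ‖ * v) + 1) by ring,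
      div_le_iff₀ (by positivity)]
    nlinarith
  have h5 : M * ‖g‖ ^ 2 ≤ M :=
    mul_le_of_le_one_right hM (pow_le_one₀ (norm_nonneg _) hg)
  have h6 := norm_sub_norm_le (inner ℂ (extendL (hopen j) f) (mulL hψ (extendL (hopen j) f)))
    (inner ℂ (extendL hΩ g) (mulL hψ (extendL hΩ g)))
  linarith

/-- The symbol is fixed on `Ω` first; only then is `j` taken large, depending on that symbol. -/
theorem exists_symbol_eventually {Ωs : ℕ → Set (Fin n → ℂ)}
    (hopen : ∀ j, IsOpen (Ωs j)) (hmono : Monotone Ωs) (hΩ : IsDomainSet (⋃ j, Ωs j))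
    (T : A2 (⋃ j, Ωs j) →L[ℂ] A2 (⋃ j, Ωs j)) {K : Set (Fin n → ℂ)} (hK : IsCompact K)
    (hKΩ : K ⊆ (⋃ j, Ωs j) \ zeroSet (⋃ j, Ωs j)) {ε : ℝ} (hε : 0 < ε) :
    ∃ (ψ : (Fin n → ℂ) → ℂ) (hψ : MemLp ψ ∞ volume), ∀ᶠ j in atTop,
      (∀ z ∈ K, ‖berezin (toeplitz (hopen j) hψ) z - berezin T z‖ ≤ ε) ∧
      ∀ z ∈ Ωs j, ‖berezin (toeplitz (hopen j) hψ) z‖ ≤ ‖T‖ + ε := by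
  obtain ⟨_, ⟨ψ, hψ, L, hL, hLΩ, hψL, rfl⟩, hnum, happrox⟩ := exists_compactToeplitz_approx hΩ T
    (hK.image_of_continuousOn ((continuousOn_normalizedKernel hΩ.1).mono hKΩ)) (half_pos hε)
  refine ⟨ψ, hψ, ?_⟩
  filter_upwards [eventually_norm_berezin_toeplitz_sub_le hopen hmono hΩ.1 hK hKΩ hψ (half_pos hε),
    eventually_norm_berezin_toeplitz_le hopen hmono hΩ.1 hL hLΩ hψ hψL (by positivity) hnum
      (half_pos hε)] with j h1 h2
  refine ⟨fun z hz => ?_, fun z hz => (h2 z hz).trans_eq (by ring)⟩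
  have h3 : ‖berezin (toeplitz hΩ.1 hψ) z - berezin T z‖ ≤ ε / 2 :=
    happrox _ (mem_image_of_mem _ hz) (norm_normalizedKernel_le hΩ.1 (hKΩ hz).1)
  have h4 := norm_add_le (berezin (toeplitz (hopen j) hψ) z - berezin (toeplitz hΩ.1 hψ) z)
    (berezin (toeplitz hΩ.1 hψ) z - berezin T z)
  rw [sub_add_sub_cancel] at h4
  linarith [h1 z hz]

/-! ### Bounded domains and convergence in `Lᵖ` -/

/-- The constant `1` is square integrable, so no reproducing kernel can vanish. -/
theorem diff_zeroSet_of_isBounded {U : Set (Fin n → ℂ)} (hU : IsOpen U)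
    (hb : Bornology.IsBounded U) : U \ zeroSet U = U := by
  refine sdiff_subset.antisymm fun z hz => (mem_diff_zeroSet_iff hU).2 ⟨hz, fun h0 => ?_⟩
  have : IsFiniteMeasure (volume.restrict U) :=
    ⟨by simpa using hb.measure_lt_top⟩
  have hm : MemLp (fun _ : Fin n → ℂ => (1 : ℂ)) 2 (volume.restrict U) := memLp_const 1
  let f : A2 U := ⟨hm.toLp _, _, differentiableOn_const 1, hm.coeFn_toLp⟩
  have hf : hol f z = 1 := hol_eqOn hU f (differentiableOn_const 1) hm.coeFn_toLp hz
  rw [← inner_kernelFun hU hz, h0, inner_zero_left] at hf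
  exact zero_ne_one hf

/-- Dominated convergence for the integrals of the `p`-th powers, which needs no triangle inequality
and so covers `p < 1`. -/
theorem tendsto_eLpNorm_zero_of_bounded {α : Type*} [MeasurableSpace α] {μ : Measure α}
    [IsFiniteMeasure μ] {f : ℕ → α → ℂ} (hf : ∀ k, AEStronglyMeasurable (f k) μ) {C : ℝ}
    (hC : ∀ k, ∀ᵐ x ∂μ, ‖f k x‖ ≤ C) (hlim : ∀ᵐ x ∂μ, Tendsto (fun k => f k x) atTop (𝓝 0))
    {p : ℝ≥0∞} (hp0 : p ≠ 0) (hp : p ≠ ∞) :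
    Tendsto (fun k => eLpNorm (f k) p μ) atTop (𝓝 0) := by
  have hpos : 0 < p.toReal := ENNReal.toReal_pos hp0 hp
  have hint : Tendsto (fun k => ∫⁻ x, ‖f k x‖ₑ ^ p.toReal ∂μ) atTop (𝓝 (∫⁻ _, 0 ∂μ)) := by
    refine tendsto_lintegral_of_dominated_convergence' (fun _ => ENNReal.ofReal C ^ p.toReal)
      (fun k => (hf k).enorm.pow_const _) (fun k => ?_) ?_ ?_
    · filter_upwards [hC k] with x hx
      gcongr
      rw [← ofReal_norm]
      exact ENNReal.ofReal_le_ofReal hx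
    · rw [lintegral_const]
      exact ENNReal.mul_ne_top (ENNReal.rpow_ne_top_of_nonneg hpos.le ENNReal.ofReal_ne_top)
        (measure_ne_top _ _)
    · filter_upwards [hlim] with x hx
      have h1 : Tendsto (fun k => ‖f k x‖ₑ) atTop (𝓝 0) := by simpa using hx.enorm
      simpa [ENNReal.zero_rpow_of_pos hpos] using h1.ennrpow_const p.toReal
  simp only [eLpNorm_eq_lintegral_rpow_enorm_toReal hp0 hp]
  have h := hint.ennrpow_const (1 / p.toReal)
  rwa [lintegral_zero, ENNReal.zero_rpow_of_pos (by positivity)] at h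

theorem exists_compact_exhaustion_of_isOpen {O : Set (Fin n → ℂ)} (hO : IsOpen O) :
    ∃ K : ℕ → Set (Fin n → ℂ), (∀ k, IsCompact (K k) ∧ K k ⊆ O) ∧
      ∀ C, IsCompact C → C ⊆ O → ∀ᶠ k in atTop, C ⊆ K k := by
  have : LocallyCompactSpace O := hO.locallyCompactSpace
  let E := CompactExhaustion.choice O
  refine ⟨fun k => Subtype.val '' E k, fun k =>
    ⟨(E.isCompact k).image continuous_subtype_val, by rintro _ ⟨x, -, rfl⟩; exact x.2⟩,
    fun C hC hCO => ?_⟩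
  have hC' : IsCompact (Subtype.val ⁻¹' C : Set O) := by
    rw [Subtype.isCompact_iff, Subtype.image_preimage_coe, inter_eq_right.2 hCO]
    exact hC
  obtain ⟨m, hm⟩ := E.exists_superset_of_isCompact hC'
  filter_upwards [eventually_ge_atTop m] with k hk z hz
  exact ⟨⟨z, hCO hz⟩, E.subset hk (hm hz), rfl⟩

end Bergman

end

/-! ### Diagonal choice of symbols and domains -/

theorem mainTheorem4 {n : ℕ} (Ωs : ℕ → Set (Fin n → ℂ)) (Ω : Set (Fin n → ℂ))
    (hdom : ∀ j, Bergman.IsDomainSet (Ωs j))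
    (hmono : ∀ j, Ωs j ⊆ Ωs (j + 1))
    (hunion : Ω = ⋃ j, Ωs j)
    (hΩ : Bergman.IsNontrivialBergmanDomain Ω)
    (q : ℝ≥0∞) (hq0 : q ≠ 0) (hqtop : q ≠ ∞)
    (φ : (Fin n → ℂ) → ℂ) (hφ : MemLp φ q (volume.restrict Ω))
    (T : Bergman.A2 Ω →L[ℂ] Bergman.A2 Ω) (hT : Bergman.IsToeplitz Ω φ T) :
    ∃ (j : ℕ → ℕ) (ψ : ℕ → (Fin n → ℂ) → ℂ)
      (S : ∀ k, Bergman.A2 (Ωs (j k)) →L[ℂ] Bergman.A2 (Ωs (j k))),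
      StrictMono j ∧
      (∀ k, MemLp (ψ k) ∞ (volume.restrict (Ωs (j k)))) ∧
      (∀ k, Bergman.IsToeplitz (Ωs (j k)) (ψ k) (S k)) ∧
      (∀ K : Set (Fin n → ℂ), IsCompact K → K ⊆ Ω \ Bergman.zeroSet Ω →
        TendstoUniformlyOn (fun k z => Bergman.berezin (S k) z) (Bergman.berezin T) atTop K) ∧
      (Bornology.IsBounded Ω → ∀ p : ℝ≥0∞, p ≠ 0 → p ≠ ∞ →
        MemLp (Bergman.berezin T) p (volume.restrict Ω) ∧
        (∀ k, MemLp ((Ωs (j k)).indicator (Bergman.berezin (S k))) p (volume.restrict Ω)) ∧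
        Tendsto (fun k => eLpNorm ((Ωs (j k)).indicator (Bergman.berezin (S k))
            - Bergman.berezin T) p (volume.restrict Ω)) atTop (𝓝 0)) := by
  subst hunion
  have hopen : ∀ j, IsOpen (Ωs j) := fun j => (hdom j).1
  have hΩo : IsOpen (⋃ j, Ωs j) := hΩ.1.1
  have hmon : Monotone Ωs := monotone_nat_of_le_succ hmono
  obtain ⟨K, hK, hKex⟩ := Bergman.exists_compact_exhaustion_of_isOpen
    (Bergman.isOpen_diff_zeroSet hΩo)
  -- The `k`-th symbol has tolerance `1 / (k + 1)` on the `k`-th compact set of an exhaustion of `Ω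
  -- ∖ 𝒵`.
  have hstep := fun k : ℕ => Bergman.exists_symbol_eventually hopen hmon hΩ.1 T (hK k).1 (hK k).2
    (ε := 1 / ((k : ℝ) + 1)) (by positivity)
  choose ψ hψ hev using hstep
  obtain ⟨j, hj, hjk⟩ := extraction_forall_of_eventually hev
  have hunif : ∀ C : Set (Fin n → ℂ), IsCompact C →
      C ⊆ (⋃ j, Ωs j) \ Bergman.zeroSet (⋃ j, Ωs j) →
      TendstoUniformlyOn (fun k z => Bergman.berezin (Bergman.toeplitz (hopen (j k)) (hψ k)) z)
        (Bergman.berezin T) atTop C := by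
    intro C hC hCΩ
    rw [Metric.tendstoUniformlyOn_iff]
    intro ε hε
    filter_upwards [hKex C hC hCΩ, tendsto_one_div_add_atTop_nhds_zero_nat.eventually
      (gt_mem_nhds hε)] with k hk1 hk2 z hz
    rw [dist_comm, dist_eq_norm]
    exact ((hjk k).1 z (hk1 hz)).trans_lt hk2
  refine ⟨j, ψ, fun k => Bergman.toeplitz (hopen (j k)) (hψ k), hj, fun k => (hψ k).restrict _,
    fun k => Bergman.isToeplitz_toeplitz _ _, hunif, fun hb p hp0 hp => ?_⟩
  have hsub : ∀ k, Ωs k ⊆ ⋃ j, Ωs j := subset_iUnion Ωs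
  have : IsFiniteMeasure (volume.restrict (⋃ j, Ωs j)) := ⟨by simpa using hb.measure_lt_top⟩
  have hTm : AEStronglyMeasurable (Bergman.berezin T) (volume.restrict (⋃ j, Ωs j)) := by
    have h := Bergman.continuousOn_berezin hΩo T
    rw [Bergman.diff_zeroSet_of_isBounded hΩo hb] at h
    exact h.aestronglyMeasurable hΩo.measurableSet
  have hSm : ∀ k, AEStronglyMeasurable ((Ωs (j k)).indicator
      (Bergman.berezin (Bergman.toeplitz (hopen (j k)) (hψ k))))
      (volume.restrict (⋃ j, Ωs j)) := by
    intro k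
    have h := Bergman.continuousOn_berezin (hopen (j k)) (Bergman.toeplitz (hopen (j k)) (hψ k))
    rw [Bergman.diff_zeroSet_of_isBounded (hopen _) (hb.subset (hsub _))] at h
    exact ((aestronglyMeasurable_indicator_iff (hopen (j k)).measurableSet).2
      (h.aestronglyMeasurable (hopen (j k)).measurableSet)).restrict
  have hTb : ∀ᵐ z ∂(volume.restrict (⋃ j, Ωs j)), ‖Bergman.berezin T z‖ ≤ ‖T‖ :=
    (ae_restrict_mem hΩo.measurableSet).mono fun z hz => Bergman.norm_berezin_le hΩo T hz
  -- As `1 / (k + 1) ≤ 1`, this bound is independent of `k` and serves as the dominating constant.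
  have hSb : ∀ k z, ‖(Ωs (j k)).indicator
      (Bergman.berezin (Bergman.toeplitz (hopen (j k)) (hψ k))) z‖ ≤ ‖T‖ + 1 := by
    intro k z
    by_cases hz : z ∈ Ωs (j k)
    · rw [indicator_of_mem hz]
      refine ((hjk k).2 z hz).trans ?_
      gcongr
      rw [div_le_one (by positivity)]
      linarith [(Nat.cast_nonneg k : (0 : ℝ) ≤ k)]
    · rw [indicator_of_notMem hz, norm_zero]
      positivity
  refine ⟨MemLp.of_bound hTm _ hTb, fun k => MemLp.of_bound (hSm k) _ (ae_of_all _ (hSb k)),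
    Bergman.tendsto_eLpNorm_zero_of_bounded (fun k => (hSm k).sub hTm)
      (C := (‖T‖ + 1) + ‖T‖) (fun k => ?_) ?_ hp0 hp⟩
  · filter_upwards [hTb] with z hz
    exact (norm_sub_le _ _).trans (add_le_add (hSb k z) hz)
  · filter_upwards [ae_restrict_mem hΩo.measurableSet] with z hz
    -- Since `𝒵` is empty, uniform convergence on singletons gives pointwise convergence on all of
    -- `Ω`.
    have hz1 : {z} ⊆ (⋃ j, Ωs j) \ Bergman.zeroSet (⋃ j, Ωs j) := by
      rw [Bergman.diff_zeroSet_of_isBounded hΩo hb]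
      exact singleton_subset_iff.2 hz
    have h1 := (hunif {z} isCompact_singleton hz1).tendsto_at (mem_singleton z)
    have h2 := tendsto_sub_nhds_zero_iff.2 h1
    refine h2.congr' ?_
    filter_upwards [hj.tendsto_atTop.eventually (Bergman.eventually_subset_of_isCompact hopen hmon
      isCompact_singleton (singleton_subset_iff.2 hz))] with k hk
    rw [Pi.sub_apply, indicator_of_mem (hk (mem_singleton z))]
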